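/- Let $T>0$, $\gamma\in(0,1)$, and let $X=(X_t)_{t\in[0,T]}$ be a zero-mean Gaussian process with $X_0=0$. Put $\sigma_X(s,t)=\sqrt{\mathbf E[X_t-X_s]^2}$, and let $\Psi$ be the class of positive measurable functions $\varphi$ on $(0,T)$ that are regularly varying at zero with index $1$ and satisfy $\varphi(h)/h\to\infty$ as $h\downarrow0$. Assume that $X$ has the Orey index $\gamma$, i.e. $\sup_{0\le s\le T-h}\sigma_X(s,s+h)\to0$ as $h\downarrow 0$ and, for every $\varphi\in\Psi$, the following four numbers are all equal to $\gamma$ (with $\inf\emptyset=+\infty$, $\sup\emptyset=0$): $$\inf\Big\{g>0:\lim_{h\downarrow0}\sup_{\varphi(h)\le s\le T-h}\tfrac{h^{g}}{\sigma_X(s,s+h)}=0\Big\},\qquad \inf\Big\{g>0:\lim_{h\downarrow0}\tfrac{h^{g}}{\sigma_X(0,h)}=0\Big\},$$ $$\sup\Big\{g>0:\lim_{h\downarrow0}\inf_{\varphi(h)\le s\le T-h}\tfrac{h^{g}}{\sigma_X(s,s+h)}=+\infty\Big\},\qquad \sup\Big\{g>0:\lim_{h\downarrow0}\tfrac{h^{g}}{\sigma_X(0,h)}=+\infty\Big\}.$$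 Let $\kappa>0$ be the normalizing constant of $X$: for every $\varphi\in\Psi$, $$\sup_{\varphi(\delta)\le t\le T-\delta}\ \sup_{0<h\le\delta}\Big|\frac{\sigma_X(t,t+h)}{\kappa h^{\gamma}}-1\Big|\longrightarrow0\qquad(\delta\downarrow0).$$ For $m\ge1$ and $1\le j,k\le m-1$ put $$\Delta^{(2)}_{m,k}\widehat X=\frac{X_{\frac{k+1}{m}T}-2X_{\frac km T}+X_{\frac{k-1}{m}T}}{\kappa\sqrt{4-2^{2\gamma}}\,(T/m)^{\gamma}},\qquad V^{\widehat X}_{m}=\sum_{k=1}^{m-1}\big(\Delta^{(2)}_{m,k}\widehat X\big)^2,\qquad d^{\widehat X,m}_{j,k}=\mathbf E\,\Delta^{(2)}_{m,j}\widehat X\,\Delta^{(2)}_{m,k}\widehat X .$$ Let $B^\gamma=(B^\gamma_t)_{t\in[0,T]}$ be a fractional Brownian motion with Hurst index $\gamma$, i.e. a zero-mean Gaussian process with $\mathbf E B^\gamma_tB^\gamma_s=\frac12(t^{2\gamma}+s^{2\gamma}-|t-s|^{2\gamma})$, and let $V^{\widehat B^\gamma}_m$ be defined in the same way from $B^\gamma$,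 with $\kappa=1$. Assume: 1. there is a constant $C$ such that $\max_{1\le k\le in-1}\sum_{j=1}^{in-1}|d^{\widehat X,in}_{j,k}|\le C$ for all $n\ge1$ and $i=1,2$; 2. $\frac1n\Big(\operatorname{cov}\big(i^{-1}V^{\widehat X}_{in},j^{-1}V^{\widehat X}_{jn}\big)-\operatorname{cov}\big(i^{-1}V^{\widehat B^\gamma}_{in},j^{-1}V^{\widehat B^\gamma}_{jn}\big)\Big)\to0$ as $n\to\infty$ for all $i,j\in\{1,2\}$; 3. $\sqrt n\,\big((in)^{-1}\mathbf E V^{\widehat X}_{in}-1\big)\to0$ as $n\to\infty$ for $i=1,2$. Then, as $n\to\infty$, $$\sqrt n\begin{pmatrix} n^{-1}V^{\widehat X}_{n}-1\\ (2n)^{-1}V^{\widehat X}_{2n}-1\end{pmatrix}\xrightarrow{\ d\ }\mathcal N(0,\Sigma_\gamma),\qquad \Sigma_\gamma=\begin{pmatrix}\Sigma_{11}&\Sigma_{12}\\ \Sigma_{12}&\tfrac12\Sigma_{11}\end{pmatrix},$$ where the matrix $\Sigma_\gamma$ is positive semidefinite, its entries are given by the convergent series $$\Sigma_{11}=2\Big(1+\frac{2}{(4-2^{2\gamma})^2}\sum_{j=1}^\infty\widehat\rho_\gamma^{\,2}(j)\Big),\qquad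 \Sigma_{12}=\frac1{2^{2\gamma}(4-2^{2\gamma})^2}\sum_{j\in\mathbb Z}\widetilde\rho_\gamma^{\,2}(j),$$ and $$\widehat\rho_\gamma(j)=\tfrac12\big[-6|j|^{2\gamma}-|j-2|^{2\gamma}-|j+2|^{2\gamma}+4|j-1|^{2\gamma}+4|j+1|^{2\gamma}\big],$$ $$\widetilde\rho_\gamma(j)=\tfrac12\big[|j+1|^{2\gamma}+2|j+2|^{2\gamma}-|j+3|^{2\gamma}+|j-1|^{2\gamma}-4|j|^{2\gamma}-|j-3|^{2\gamma}+2|j-2|^{2\gamma}\big].$$ -/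

import Mathlib

open MeasureTheory ProbabilityTheory Filter Topology
open scoped ENNReal

namespace OreyCLT

noncomputable section

/-- `f` is a positive measurable function on `(0,T)` that is regularly varying at zero
with index `ρ`. -/
structure RegularlyVaryingAtZero (T ρ : ℝ) (f : ℝ → ℝ) : Prop where
  pos : ∀ h ∈ Set.Ioo 0 T, 0 < f h
  measurable : Measurable (fun h : Set.Ioo 0 T => f h)
  tendsto_ratio : ∀ l : ℝ, 0 < l →
    Tendsto (fun h => f (l * h) / f h) (𝓝[>] 0) (𝓝 (l ^ ρ))

/-- The class `Ψ`: functions regularly varying at zero with index `1` such that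
`φ(h) / h → ∞` as `h ↓ 0`. -/
def Psi (T : ℝ) : Set (ℝ → ℝ) :=
  {φ | RegularlyVaryingAtZero T 1 φ ∧ Tendsto (fun h => φ h / h) (𝓝[>] 0) atTop}

section Paths

variable {Ω : Type*} [MeasurableSpace Ω]

/-- The process `(X_t)`, restricted to `t ∈ [0,T]`, is Gaussian with zero mean. -/
structure IsCenteredGaussianOn (X : ℝ → Ω → ℝ) (P : Measure Ω) (T : ℝ) : Prop where
  gaussian : IsGaussianProcess (fun t : Set.Icc (0 : ℝ) T => X t) P
  mean_zero : ∀ t ∈ Set.Icc (0 : ℝ) T, P[X t] = 0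

/-- Fractional Brownian motion on `[0,T]` with Hurst index `γ`. -/
structure IsFBM (B : ℝ → Ω → ℝ) (P : Measure Ω) (T γ : ℝ) : Prop extends
    IsCenteredGaussianOn B P T where
  covariance_eq : ∀ t ∈ Set.Icc (0 : ℝ) T, ∀ s ∈ Set.Icc (0 : ℝ) T,
    ∫ ω, B t ω * B s ω ∂P =
      (1 / 2) * (t ^ (2 * γ) + s ^ (2 * γ) - |t - s| ^ (2 * γ))

/-- `σ_X(s,t)`, the square root of the incremental variance function `E[X_t - X_s]²`. -/
def sigma (X : ℝ → Ω → ℝ) (P : Measure Ω) (s t : ℝ) : ℝ :=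
  √(∫ ω, (X t ω - X s ω) ^ 2 ∂P)

/-- `h^g / σ_X(s,s+h)` as an extended non-negative number, equal to `+∞` (for `h > 0`) when the
denominator vanishes. -/
def incRatio (X : ℝ → Ω → ℝ) (P : Measure Ω) (g s h : ℝ) : ℝ≥0∞ :=
  ENNReal.ofReal (h ^ g) / ENNReal.ofReal (sigma X P s (s + h))

/-- `γ_*(φ)`. -/
def gammaLow (X : ℝ → Ω → ℝ) (P : Measure Ω) (T : ℝ) (φ : ℝ → ℝ) : ℝ≥0∞ :=
  sInf {x | ∃ g : ℝ, 0 < g ∧ x = ENNReal.ofReal g ∧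
    Tendsto (fun h => ⨆ s ∈ Set.Icc (φ h) (T - h), incRatio X P g s h) (𝓝[>] 0) (𝓝 0)}

/-- `γ̃_*`. -/
def gammaLowZero (X : ℝ → Ω → ℝ) (P : Measure Ω) : ℝ≥0∞ :=
  sInf {x | ∃ g : ℝ, 0 < g ∧ x = ENNReal.ofReal g ∧
    Tendsto (fun h => incRatio X P g 0 h) (𝓝[>] 0) (𝓝 0)}

/-- `γ^*(φ)`. -/
def gammaUp (X : ℝ → Ω → ℝ) (P : Measure Ω) (T : ℝ) (φ : ℝ → ℝ) : ℝ≥0∞ :=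
  sSup {x | ∃ g : ℝ, 0 < g ∧ x = ENNReal.ofReal g ∧
    Tendsto (fun h => ⨅ s ∈ Set.Icc (φ h) (T - h), incRatio X P g s h) (𝓝[>] 0) (𝓝 ⊤)}

/-- `γ̃^*`. -/
def gammaUpZero (X : ℝ → Ω → ℝ) (P : Measure Ω) : ℝ≥0∞ :=
  sSup {x | ∃ g : ℝ, 0 < g ∧ x = ENNReal.ofReal g ∧
    Tendsto (fun h => incRatio X P g 0 h) (𝓝[>] 0) (𝓝 ⊤)}

/-- The process `(X_t)_{t ∈ [0,T]}` has the Orey index `γ`. -/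
structure HasOreyIndex (X : ℝ → Ω → ℝ) (P : Measure Ω) (T γ : ℝ) : Prop where
  nonneg : 0 ≤ γ
  tendsto_sigma : Tendsto
    (fun h => ⨆ s ∈ Set.Icc 0 (T - h), ENNReal.ofReal (sigma X P s (s + h))) (𝓝[>] 0) (𝓝 0)
  gammaLowZero_eq : gammaLowZero X P = ENNReal.ofReal γ
  gammaUpZero_eq : gammaUpZero X P = ENNReal.ofReal γ
  gammaLow_eq : ∀ φ ∈ Psi T, gammaLow X P T φ = ENNReal.ofReal γ
  gammaUp_eq : ∀ φ ∈ Psi T, gammaUp X P T φ = ENNReal.ofReal γ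

/-- `κ > 0` is the normalizing constant of the increments of `X`: for every `φ ∈ Ψ`,
`sup_{φ(δ) ≤ t ≤ T-δ} sup_{0 < h ≤ δ} |σ_X(t,t+h) / (κ h^γ) - 1| → 0` as `δ ↓ 0`. -/
structure IsNormalizingConstant (X : ℝ → Ω → ℝ) (P : Measure Ω) (T γ κ : ℝ) : Prop where
  pos : 0 < κ
  tendsto_sup : ∀ φ ∈ Psi T, Tendsto
    (fun δ => ⨆ t ∈ Set.Icc (φ δ) (T - δ), ⨆ h ∈ Set.Ioc 0 δ,
      ENNReal.ofReal |sigma X P t (t + h) / (κ * h ^ γ) - 1|) (𝓝[>] 0) (𝓝 0)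

/-- `Δ⁽²⁾_{m,k} X = X_{(k+1)T/m} - 2 X_{kT/m} + X_{(k-1)T/m}`, for `1 ≤ k ≤ m - 1`. -/
def secondInc (X : ℝ → Ω → ℝ) (T : ℝ) (m k : ℕ) (ω : Ω) : ℝ :=
  X (((k : ℝ) + 1) / m * T) ω - 2 * X ((k : ℝ) / m * T) ω + X (((k : ℝ) - 1) / m * T) ω

/-- The second-order increment normalized by `κ √(4 - 2^{2γ}) (T/m)^γ`. -/
def normInc (X : ℝ → Ω → ℝ) (T γ κ : ℝ) (m k : ℕ) (ω : Ω) : ℝ :=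
  secondInc X T m k ω / (κ * √(4 - (2 : ℝ) ^ (2 * γ)) * (T / m) ^ γ)

/-- The normalized second-order quadratic variation `V_m = ∑_{k=1}^{m-1} (normInc m k)²`. -/
def quadVar (X : ℝ → Ω → ℝ) (T γ κ : ℝ) (m : ℕ) (ω : Ω) : ℝ :=
  ∑ k ∈ Finset.Icc 1 (m - 1), (normInc X T γ κ m k ω) ^ 2

/-- `d_{j,k}`, the covariance of two normalized second-order increments. -/
def incCov (X : ℝ → Ω → ℝ) (P : Measure Ω) (T γ κ : ℝ) (m j k : ℕ) : ℝ :=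
  ∫ ω, normInc X T γ κ m j ω * normInc X T γ κ m k ω ∂P

end Paths

/-- `ρ̂_γ(j)`. -/
def rhoHat (γ : ℝ) (j : ℤ) : ℝ :=
  (1 / 2) * (-6 * |(j : ℝ)| ^ (2 * γ) - |(j : ℝ) - 2| ^ (2 * γ) - |(j : ℝ) + 2| ^ (2 * γ)
    + 4 * |(j : ℝ) - 1| ^ (2 * γ) + 4 * |(j : ℝ) + 1| ^ (2 * γ))

/-- `ρ̃_γ(j)`. -/
def rhoTilde (γ : ℝ) (j : ℤ) : ℝ :=
  (1 / 2) * (|(j : ℝ) + 1| ^ (2 * γ) + 2 * |(j : ℝ) + 2| ^ (2 * γ) - |(j : ℝ) + 3| ^ (2 * γ)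
    + |(j : ℝ) - 1| ^ (2 * γ) - 4 * |(j : ℝ)| ^ (2 * γ)
    - |(j : ℝ) - 3| ^ (2 * γ) + 2 * |(j : ℝ) - 2| ^ (2 * γ))

/-- `Σ₁₁`; the series over `j = 1, 2, …` is indexed by `j - 1 ∈ ℕ`. -/
def sigma11 (γ : ℝ) : ℝ :=
  2 * (1 + 2 / (4 - (2 : ℝ) ^ (2 * γ)) ^ 2 * ∑' j : ℕ, (rhoHat γ ((j : ℤ) + 1)) ^ 2)

/-- `Σ₁₂`. -/
def sigma12 (γ : ℝ) : ℝ :=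
  1 / ((2 : ℝ) ^ (2 * γ) * (4 - (2 : ℝ) ^ (2 * γ)) ^ 2) * ∑' j : ℤ, (rhoTilde γ j) ^ 2

/-- The limiting covariance matrix `Σ_γ`. -/
def SigmaMatrix (γ : ℝ) : Matrix (Fin 2) (Fin 2) ℝ :=
  !![sigma11 γ, sigma12 γ; sigma12 γ, (1 / 2) * sigma11 γ]

end

end OreyCLT

/-! Fix `a`, `b`. The combination `a V_n / √n + b V_{2n} / (2 √n)` is a diagonal quadratic form `∑ c
i Y i ^ 2` in the centered Gaussian vector `Y` of the increments at both scales. Let `Γ` be its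
covariance matrix and `A = √Γ`. Since `Y` has the law of `A ξ` with `ξ` standard Gaussian,
diagonalizing `A diag(c) A` turns the centered form into `∑ λ i (ξ i ^ 2 - 1)` in law
(`exists_charFun_sum_mul_sq`). Two facts about the `λ i` then suffice.

Their squares sum to `∑ c i c j Γ i j ^ 2`, which by Isserlis' formula is half the variance of the
form. Each of them is at most `max |c|` times a bound for the quadratic form of `Γ`; Schur's test
and assumption 1 make this `O(1 / √n)`. As the characteristic function of `ξ ^ 2 - 1` is `exp (-l ^
2) + o(l ^ 2)`, the product over `i` differs from `exp (-∑ λ i ^ 2)` by `o(∑ λ i ^ 2)`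
(`norm_charFun_sum_mul_sq_sub_le`), so only the variance remains to be found.

Assumption 2 transfers the variance to fractional Brownian motion. There the covariances of
increments are exactly `ρ̂ (j - k)` and `ρ̃ (2 j - k)` up to constants. The sequences are square
summable because `ρ̂` is a fourth difference of `|x| ^ (2 γ)`, and the normalized double sums of
their squares converge to the full series (`tendsto_average_sum`).

Assumption 3 turns centering at the mean into centering at 1: the resulting deterministic phase
tends to 1. Convergence of characteristic functions on the plane gives the result. Positive
semidefiniteness comes for free, the limiting quadratic form being a limit of sums `∑ λ i ^ 2`. -/

namespace OreyCLT

/-! ### Decay of the covariance sequences -/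

/-- A function whose derivative is bounded by `C` on `[a, ∞)` has unit increments bounded by `C`
there. -/
lemma abs_unit_increment_le {f f' : ℝ → ℝ} {a C : ℝ} (hf : ∀ y, a ≤ y → HasDerivAt f (f' y) y)
    (hC : ∀ y, a ≤ y → |f' y| ≤ C) {y : ℝ} (hy : a ≤ y) : |f (y + 1) - f y| ≤ C := by
  have h := (convex_Ici a).norm_image_sub_le_of_norm_hasDerivWithin_le (f := f) (f' := f') (C := C)
    (x := y) (y := y + 1) (fun x hx => (hf x hx).hasDerivWithinAt) (fun x hx => hC x hx) hy
    (le_trans hy (by linarith) : a ≤ y + 1)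
  simpa using h

/-- Third-order unit increments of `x ↦ x ^ p` decay like `x ^ (p - 3)`. -/
lemma abs_third_increment_rpow_le {p a : ℝ} (hp : p ≤ 2) (ha : 0 < a) {y : ℝ} (hy : a ≤ y) :
    |(y + 3) ^ p - 3 * (y + 2) ^ p + 3 * (y + 1) ^ p - y ^ p|
      ≤ |p * (p - 1) * (p - 2)| * a ^ (p - 3) := by
  have key : ∀ (q z : ℝ), a ≤ z → HasDerivAt (fun x : ℝ => x ^ q) (q * z ^ (q - 1)) z :=
    fun q z hz => Real.hasDerivAt_rpow_const (Or.inl (by linarith : z ≠ 0))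
  have shift : ∀ (f f' : ℝ → ℝ), (∀ z, a ≤ z → HasDerivAt f (f' z) z) → ∀ z, a ≤ z →
      HasDerivAt (fun x => f (x + 1) - f x) (f' (z + 1) - f' z) z := fun f f' hf z hz =>
    (HasDerivAt.comp_add_const z 1 (hf (z + 1) (by linarith))).sub (hf z hz)
  have h1 := key p
  have h2 : ∀ z, a ≤ z → HasDerivAt (fun x : ℝ => p * x ^ (p - 1))
      (p * (p - 1) * z ^ (p - 2)) z := fun z hz => by
    have := (key (p - 1) z hz).const_mul p
    rwa [show p - 1 - 1 = p - 2 by ring, ← mul_assoc] at this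
  have h3 : ∀ z, a ≤ z → HasDerivAt (fun x : ℝ => p * (p - 1) * x ^ (p - 2))
      (p * (p - 1) * (p - 2) * z ^ (p - 3)) z := fun z hz => by
    have := (key (p - 2) z hz).const_mul (p * (p - 1))
    rwa [show p - 2 - 1 = p - 3 by ring, ← mul_assoc] at this
  have b3 : ∀ z, a ≤ z → |p * (p - 1) * (p - 2) * z ^ (p - 3)|
      ≤ |p * (p - 1) * (p - 2)| * a ^ (p - 3) := fun z hz => by
    rw [abs_mul, abs_of_nonneg (Real.rpow_nonneg (ha.le.trans hz) _)]
    exact mul_le_mul_of_nonneg_left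
      (Real.rpow_le_rpow_of_nonpos ha hz (by linarith)) (abs_nonneg _)
  -- Unit differencing commutes with differentiation, so each use of the mean value inequality
  -- trades one derivative for one difference, from the third derivative down to the function.
  have b2 := fun z (hz : a ≤ z) => abs_unit_increment_le h3 b3 hz
  have b1 := fun z (hz : a ≤ z) => abs_unit_increment_le (shift _ _ h2) b2 hz
  have b0 := abs_unit_increment_le (shift _ _ (shift _ _ h1)) b1 hy
  convert b0 using 2
  rw [show y + 1 + 1 + 1 = y + 3 by ring, show y + 1 + 1 = y + 2 by ring]
  ring

lemma rhoHat_neg (γ : ℝ) (j : ℤ) : rhoHat γ (-j) = rhoHat γ j := by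
  unfold rhoHat
  push_cast
  rw [abs_neg, show -(j : ℝ) - 2 = -(j + 2) by ring, show -(j : ℝ) + 2 = -(j - 2) by ring,
    show -(j : ℝ) - 1 = -(j + 1) by ring, show -(j : ℝ) + 1 = -(j - 1) by ring]
  simp only [abs_neg]
  ring

lemma rhoHat_zero {γ : ℝ} (hγ : 0 < γ) : rhoHat γ 0 = 4 - (2 : ℝ) ^ (2 * γ) := by
  have : (0 : ℝ) ^ (2 * γ) = 0 := Real.zero_rpow (by positivity)
  simp [rhoHat, this]
  ring

/-- A second difference of step 2 is the `(1, 2, 1)`-weighted sum of three neighboring second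
differences of step 1. Square summability of `ρ̃` thus reduces to that of `ρ̂`. -/
lemma rhoTilde_eq (γ : ℝ) (j : ℤ) :
    rhoTilde γ j = rhoHat γ (j - 1) + 2 * rhoHat γ j + rhoHat γ (j + 1) := by
  unfold rhoTilde rhoHat
  push_cast
  rw [show (j : ℝ) - 1 - 2 = j - 3 by ring, show (j : ℝ) - 1 + 2 = j + 1 by ring,
    show (j : ℝ) - 1 - 1 = j - 2 by ring, show (j : ℝ) - 1 + 1 = j by ring,
    show (j : ℝ) + 1 - 2 = j - 1 by ring, show (j : ℝ) + 1 + 2 = j + 3 by ring,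
    show (j : ℝ) + 1 - 1 = j by ring, show (j : ℝ) + 1 + 1 = j + 2 by ring]
  ring

/-- `ρ̂` is `-1/2` times a fourth difference of `|x| ^ (2 γ)`, hence a difference of two third
differences. Treating these separately loses one power of decay, but the exponent `2 γ - 3` is ample
for square summability. The shift by 3 keeps all arguments positive, so the absolute values
disappear. -/
lemma abs_rhoHat_le {γ : ℝ} (hγ : γ ≤ 1) (n : ℕ) :
    |rhoHat γ ((n : ℤ) + 3)| ≤
      |2 * γ * (2 * γ - 1) * (2 * γ - 2)| * ((n : ℝ) + 1) ^ (2 * γ - 3) := by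
  have hn : (0 : ℝ) < n + 1 := by positivity
  have h1 := abs_third_increment_rpow_le (p := 2 * γ) (by linarith) hn (le_refl ((n : ℝ) + 1))
  have h2 := abs_third_increment_rpow_le (p := 2 * γ) (by linarith) hn
    (show (n : ℝ) + 1 ≤ n + 1 + 1 by linarith)
  have e : rhoHat γ ((n : ℤ) + 3) =
      -(1 / 2) * (((n : ℝ) + 1 + 1 + 3) ^ (2 * γ) - 3 * ((n : ℝ) + 1 + 1 + 2) ^ (2 * γ)
        + 3 * ((n : ℝ) + 1 + 1 + 1) ^ (2 * γ) - ((n : ℝ) + 1 + 1) ^ (2 * γ))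
      + (1 / 2) * (((n : ℝ) + 1 + 3) ^ (2 * γ) - 3 * ((n : ℝ) + 1 + 2) ^ (2 * γ)
        + 3 * ((n : ℝ) + 1 + 1) ^ (2 * γ) - ((n : ℝ) + 1) ^ (2 * γ)) := by
    have hn0 : (0 : ℝ) ≤ n := Nat.cast_nonneg n
    unfold rhoHat
    push_cast
    rw [abs_of_nonneg (by linarith : (0 : ℝ) ≤ (n : ℝ) + 3),
      abs_of_nonneg (by linarith : (0 : ℝ) ≤ (n : ℝ) + 3 - 2),
      abs_of_nonneg (by linarith : (0 : ℝ) ≤ (n : ℝ) + 3 + 2),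
      abs_of_nonneg (by linarith : (0 : ℝ) ≤ (n : ℝ) + 3 - 1),
      abs_of_nonneg (by linarith : (0 : ℝ) ≤ (n : ℝ) + 3 + 1),
      show (n : ℝ) + 3 - 2 = n + 1 by ring, show (n : ℝ) + 3 + 2 = n + 5 by ring,
      show (n : ℝ) + 3 - 1 = n + 2 by ring, show (n : ℝ) + 3 + 1 = n + 4 by ring,
      show (n : ℝ) + 1 + 1 + 3 = n + 5 by ring, show (n : ℝ) + 1 + 1 + 2 = n + 4 by ring,
      show (n : ℝ) + 1 + 1 + 1 = n + 3 by ring, show (n : ℝ) + 1 + 1 = n + 2 by ring,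
      show (n : ℝ) + 1 + 3 = n + 4 by ring, show (n : ℝ) + 1 + 2 = n + 3 by ring]
    ring
  rw [e]
  refine (abs_add_le _ _).trans ?_
  rw [abs_mul, abs_mul]
  norm_num at h1 h2 ⊢
  linarith

lemma summable_rhoHat_sq_nat {γ : ℝ} (hγ : γ < 1) :
    Summable (fun j : ℕ => rhoHat γ (j : ℤ) ^ 2) := by
  rw [← summable_nat_add_iff 3]
  have hs : Summable (fun n : ℕ => ((n : ℝ) ^ (2 * (2 * γ - 3)))) :=
    Real.summable_nat_rpow.2 (by linarith)
  have hs' := ((summable_nat_add_iff 1).2 hs).mul_left (|2 * γ * (2 * γ - 1) * (2 * γ - 2)| ^ 2)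
  refine Summable.of_nonneg_of_le (fun n => sq_nonneg _) (fun n => ?_) hs'
  have h := pow_le_pow_left₀ (abs_nonneg _) (abs_rhoHat_le hγ.le n) 2
  rw [sq_abs, mul_pow, ← Real.rpow_natCast (((n : ℝ) + 1) ^ (2 * γ - 3)), ← Real.rpow_mul
    (by positivity)] at h
  push_cast at h ⊢
  rwa [mul_comm 2 (2 * γ - 3)]

lemma summable_rhoHat_sq {γ : ℝ} (hγ : γ < 1) : Summable (fun j : ℤ => rhoHat γ j ^ 2) := by
  refine Summable.of_nat_of_neg (summable_rhoHat_sq_nat hγ) ?_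
  simpa only [rhoHat_neg] using summable_rhoHat_sq_nat hγ

lemma summable_rhoTilde_sq {γ : ℝ} (hγ : γ < 1) : Summable (fun j : ℤ => rhoTilde γ j ^ 2) := by
  have h := summable_rhoHat_sq hγ
  have hm : Summable (fun j : ℤ => rhoHat γ (j - 1) ^ 2) :=
    h.comp_injective (sub_left_injective (b := (1 : ℤ)))
  have hp : Summable (fun j : ℤ => rhoHat γ (j + 1) ^ 2) :=
    h.comp_injective (add_left_injective (1 : ℤ))
  refine Summable.of_nonneg_of_le (fun n => sq_nonneg _) (fun j => ?_)
    (((hm.add (h.mul_left 4)).add hp).mul_left 3)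
  -- Cauchy–Schwarz in the form `(x + 2 y + z) ^ 2 ≤ 3 (x ^ 2 + 4 y ^ 2 + z ^ 2)`; the three squares
  -- supplied add up to the gap.
  rw [rhoTilde_eq]
  nlinarith [sq_nonneg (rhoHat γ (j - 1) - 2 * rhoHat γ j),
    sq_nonneg (rhoHat γ (j - 1) - rhoHat γ (j + 1)),
    sq_nonneg (rhoHat γ (j + 1) - 2 * rhoHat γ j)]

/-- Evenness folds the two-sided series that the lattice average produces into the one-sided series
of `sigma11`. -/
lemma tsum_rhoHat_sq {γ : ℝ} (hγ : γ ∈ Set.Ioo (0 : ℝ) 1) :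
    ∑' j : ℤ, rhoHat γ j ^ 2 =
      (4 - (2 : ℝ) ^ (2 * γ)) ^ 2 + 2 * ∑' j : ℕ, rhoHat γ ((j : ℤ) + 1) ^ 2 := by
  have h := summable_rhoHat_sq_nat hγ.2
  have h1 := (summable_nat_add_iff 1).2 h
  push_cast at h1
  have h2 : HasSum (fun j : ℕ => rhoHat γ (-((j : ℤ) + 1)) ^ 2)
      (∑' j : ℕ, rhoHat γ ((j : ℤ) + 1) ^ 2) := by
    simpa only [rhoHat_neg] using h1.hasSum
  rw [(h1.hasSum.of_add_one_of_neg_add_one (f := fun j : ℤ => rhoHat γ j ^ 2) h2).tsum_eq,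
    rhoHat_zero hγ.1]
  ring

/-! ### Averages along a lattice -/

/-- Group the terms by `m = r j - k`. Each `j` admits at most one `k`, so `a m` is counted `c n m ≤
n` times, and all but a bounded number of the `j` do contribute. Hence `c n m / n` tends to 1 and is
at most 1, and dominated convergence applies. The factor `r` leaves no trace in the limit because
only `j` is averaged. -/
lemma tendsto_average_sum {a : ℤ → ℝ} (ha : Summable a) {r : ℕ} (hr : 1 ≤ r) :
    Tendsto (fun n : ℕ => (1 / (n : ℝ)) * ∑ j ∈ Finset.Icc 1 (n - 1),
      ∑ k ∈ Finset.Icc 1 (r * n - 1), a (r * j - k)) atTop (𝓝 (∑' m, a m)) := by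
  classical
  let S : ℕ → ℕ → Finset ℤ := fun n j =>
    (Finset.Icc 1 (r * n - 1)).image (fun k : ℕ => (r : ℤ) * j - k)
  let c : ℕ → ℤ → ℝ := fun n m => (((Finset.Icc 1 (n - 1)).filter (fun j => m ∈ S n j)).card : ℝ)
  have hind : ∀ n m, ∑ j ∈ Finset.Icc 1 (n - 1), Set.indicator (↑(S n j)) a m = c n m * a m := by
    intro n m
    simp only [c, Set.indicator_apply, Finset.mem_coe]
    rw [← Finset.sum_filter, Finset.sum_const, nsmul_eq_mul]
  have hsum : ∀ n : ℕ, (1 / (n : ℝ)) * ∑ j ∈ Finset.Icc 1 (n - 1),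
      ∑ k ∈ Finset.Icc 1 (r * n - 1), a (r * j - k) = ∑' m, (1 / (n : ℝ)) * (c n m * a m) := by
    intro n
    rw [tsum_mul_left]
    congr 1
    simp_rw [← hind]
    rw [Summable.tsum_finsetSum (fun j _ => ha.indicator _)]
    refine Finset.sum_congr rfl fun j _ => ?_
    rw [← sum_eq_tsum_indicator, Finset.sum_image]
    intro k _ k' _ h
    simpa using h
  simp_rw [hsum]
  have hcle : ∀ n m, c n m ≤ n := by
    intro n m
    simp only [c]
    refine Nat.cast_le.2 ((Finset.card_filter_le _ _).trans ?_)
    simp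
  -- For `|m| + 1 ≤ j ≤ n - 1 - |m|` the index `k = r j - m` lies in `[1, r n - 1]`, because `r j ≥
  -- j` and `r (n - j) ≥ n - j`.
  have hcge : ∀ (n : ℕ) (m : ℤ), (n : ℝ) - (1 + 2 * |(m : ℝ)|) ≤ c n m := by
    intro n m
    have hsub : Finset.Icc (m.natAbs + 1) (n - 1 - m.natAbs) ⊆
        (Finset.Icc 1 (n - 1)).filter (fun j => m ∈ S n j) := by
      intro j hj
      rw [Finset.mem_Icc] at hj
      simp only [Finset.mem_filter, Finset.mem_Icc, S, Finset.mem_image]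
      have h1 : (j : ℤ) ≤ r * j := le_mul_of_one_le_left (by positivity) (by exact_mod_cast hr)
      have h2 : ((n : ℤ) - j) ≤ r * (n - j) :=
        le_mul_of_one_le_left (by omega) (by exact_mod_cast hr)
      have h3 : (r : ℤ) * (n - j) = r * n - r * j := by ring
      refine ⟨by omega, ((r : ℤ) * j - m).toNat, ?_, ?_⟩
      · zify
        have : 1 ≤ r * n := Nat.mul_pos hr (by omega)
        push_cast [this]
        omega
      · omega
    have := Finset.card_le_card hsub
    rw [Nat.card_Icc] at this
    have habs := Int.natCast_natAbs m
    have h4 : (n : ℤ) ≤ ((Finset.Icc 1 (n - 1)).filter (fun j => m ∈ S n j)).card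
        + 1 + 2 * |m| := by omega
    have h5 := (Int.cast_le (R := ℝ)).2 h4
    push_cast at h5
    simp only [c]
    linarith
  refine tendsto_tsum_of_dominated_convergence (bound := fun m => |a m|) ha.abs ?_ ?_
  · intro m
    have hlim : Tendsto (fun n : ℕ => (1 / (n : ℝ)) * c n m) atTop (𝓝 1) := by
      have h0 : Tendsto (fun n : ℕ => 1 - (1 + 2 * |(m : ℝ)|) / (n : ℝ)) atTop (𝓝 (1 - 0)) :=
        tendsto_const_nhds.sub (tendsto_const_div_atTop_nhds_zero_nat _)
      rw [sub_zero] at h0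
      refine tendsto_of_tendsto_of_tendsto_of_le_of_le' h0 tendsto_const_nhds ?_ ?_
      · filter_upwards [eventually_gt_atTop 0] with n hn
        have hn' : (0 : ℝ) < n := by exact_mod_cast hn
        rw [one_div, ← div_eq_inv_mul, le_div_iff₀ hn', sub_mul, div_mul_cancel₀ _ hn'.ne', one_mul]
        exact hcge n m
      · filter_upwards [eventually_gt_atTop 0] with n hn
        have hn' : (0 : ℝ) < n := by exact_mod_cast hn
        rw [one_div, ← div_eq_inv_mul, div_le_one hn']
        exact hcle n m
    have := hlim.mul_const (a m)
    simpa only [one_mul, mul_assoc] using this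
  · filter_upwards [eventually_gt_atTop 0] with n hn m
    have hn' : (0 : ℝ) < n := by exact_mod_cast hn
    rw [Real.norm_eq_abs, ← mul_assoc, abs_mul]
    refine mul_le_of_le_one_left (abs_nonneg _) ?_
    rw [abs_of_nonneg (by positivity), one_div, ← div_eq_inv_mul, div_le_one hn']
    exact hcle n m

/-! ### Moments of Gaussian variables -/

/-- The fourth moment is the fourth derivative at 0 of the moment generating function `exp (v t ^ 2
/ 2)`. Each derivative is a polynomial times that exponential, with `p` replaced by `p' + v t p`. -/
lemma integral_pow_four_gaussianReal (v : NNReal) :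
    ∫ x, x ^ 4 ∂gaussianReal 0 v = 3 * (v : ℝ) ^ 2 := by
  have hexp : ∀ t : ℝ, HasDerivAt (fun t : ℝ => Real.exp (v * t ^ 2 / 2))
      (v * t * Real.exp (v * t ^ 2 / 2)) t := fun t => by
    have := (((hasDerivAt_pow 2 t).const_mul (v : ℝ)).div_const 2).exp
    convert this using 1
    push_cast
    ring
  have hstep : ∀ p p' q : ℝ → ℝ, (∀ t, HasDerivAt p (p' t) t) →
      (∀ t, q t = p' t + p t * (v * t)) →
      deriv (fun t => p t * Real.exp (v * t ^ 2 / 2))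
        = fun t => q t * Real.exp (v * t ^ 2 / 2) := by
    intro p p' q hp hq
    ext t
    rw [((hp t).fun_mul (hexp t)).deriv, hq]
    ring
  have hid : ∀ t : ℝ, HasDerivAt (fun t : ℝ => (v : ℝ) * t) v t := fun t => by
    simpa using (hasDerivAt_id' t).const_mul (v : ℝ)
  have hsq : ∀ t : ℝ, HasDerivAt (fun t : ℝ => (v : ℝ) + v ^ 2 * t ^ 2) (2 * v ^ 2 * t) t :=
    fun t => by
      refine (((hasDerivAt_pow 2 t).const_mul ((v : ℝ) ^ 2)).const_add (v : ℝ)).congr_deriv ?_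
      norm_num
      ring
  have hcube : ∀ t : ℝ, HasDerivAt (fun t : ℝ => 3 * (v : ℝ) ^ 2 * t + v ^ 3 * t ^ 3)
      (3 * v ^ 2 + 3 * v ^ 3 * t ^ 2) t := fun t => by
    refine (((hasDerivAt_id' t).const_mul (3 * (v : ℝ) ^ 2)).fun_add
      ((hasDerivAt_pow 3 t).const_mul ((v : ℝ) ^ 3))).congr_deriv ?_
    norm_num
    ring
  have h : iteratedDeriv 4 (fun t : ℝ => (1 : ℝ) * Real.exp (v * t ^ 2 / 2)) 0
      = 3 * (v : ℝ) ^ 2 := by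
    rw [iteratedDeriv_succ', hstep _ (fun _ => 0) (fun t => v * t)
        (fun t => hasDerivAt_const t (1 : ℝ)) (fun t => by ring),
      iteratedDeriv_succ', hstep _ _ (fun t => v + v ^ 2 * t ^ 2) hid (fun t => by ring),
      iteratedDeriv_succ', hstep _ _ (fun t => 3 * v ^ 2 * t + v ^ 3 * t ^ 3) hsq
        (fun t => by ring),
      iteratedDeriv_one, hstep _ _ (fun t => 3 * v ^ 2 + 6 * v ^ 3 * t ^ 2 + v ^ 4 * t ^ 4) hcube
        (fun t => by ring)]
    simp
  have h2 := iteratedDeriv_mgf_zero (X := fun x : ℝ => x) (μ := gaussianReal 0 v) (by simp) 4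
  rw [mgf_fun_id_gaussianReal] at h2
  simp only [zero_mul, zero_add, one_mul] at h h2
  rw [← h, h2]
  rfl

section Moments

variable {Ω : Type*} [MeasurableSpace Ω] {P : Measure Ω} {U V : Ω → ℝ}

lemma integral_pow_four_of_hasGaussianLaw (hU : HasGaussianLaw U P) (h0 : P[U] = 0) :
    ∫ ω, U ω ^ 4 ∂P = 3 * (∫ ω, U ω ^ 2 ∂P) ^ 2 := by
  have h := hU.map_eq_gaussianReal
  rw [h0] at h
  have h4 : ∫ ω, U ω ^ 4 ∂P = ∫ x, x ^ 4 ∂(P.map U) := by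
    rw [integral_map hU.aemeasurable (by fun_prop)]
  have hv := variance_eq_integral hU.aemeasurable
  rw [h0] at hv
  simp only [sub_zero] at hv
  rw [h4, h, integral_pow_four_gaussianReal, Real.coe_toNNReal _ (variance_nonneg _ _), hv]

lemma integrable_pow_four_of_hasGaussianLaw (hU : HasGaussianLaw U P) :
    Integrable (fun ω => U ω ^ 4) P := by
  have := (hU.memLp (p := ((4 : ℕ) : ℝ≥0∞)) (by simp)).integrable_norm_pow (by norm_num)
  simpa [Even.pow_abs (by decide : Even 4)] using this

lemma integrable_sq_of_hasGaussianLaw (hU : HasGaussianLaw U P) :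
    Integrable (fun ω => U ω ^ 2) P := hU.memLp_two.integrable_sq

lemma memLp_sq_of_hasGaussianLaw (hU : HasGaussianLaw U P) :
    MemLp (fun ω => U ω ^ 2) 2 P := by
  rw [memLp_two_iff_integrable_sq (hU.aemeasurable.pow_const 2).aestronglyMeasurable]
  simpa [← pow_mul] using integrable_pow_four_of_hasGaussianLaw hU

/-- Isserlis' formula for the covariance of the squares of two centered jointly Gaussian
variables. -/
lemma covariance_sq_sq_of_hasGaussianLaw (h : HasGaussianLaw (fun ω => (U ω, V ω)) P)
    (hU0 : P[U] = 0) (hV0 : P[V] = 0) :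
    cov[fun ω => U ω ^ 2, fun ω => V ω ^ 2; P] = 2 * (∫ ω, U ω * V ω ∂P) ^ 2 := by
  have : IsProbabilityMeasure P := h.isProbabilityMeasure
  have hU := h.fst
  have hV := h.snd
  have hS := h.fun_add
  have hD := h.fun_sub
  have hS0 : P[fun ω => U ω + V ω] = 0 := by
    rw [integral_add hU.integrable hV.integrable, hU0, hV0, add_zero]
  have hD0 : P[fun ω => U ω - V ω] = 0 := by
    rw [integral_sub hU.integrable hV.integrable, hU0, hV0, sub_zero]
  have iUV : Integrable (fun ω => U ω * V ω) P := hU.memLp_two.integrable_mul hV.memLp_two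
  have iS : Integrable (fun ω => U ω ^ 2 + 2 * (U ω * V ω)) P :=
    (integrable_sq_of_hasGaussianLaw hU).add (iUV.const_mul 2)
  have iD : Integrable (fun ω => U ω ^ 2 - 2 * (U ω * V ω)) P :=
    (integrable_sq_of_hasGaussianLaw hU).sub (iUV.const_mul 2)
  have s2 : ∫ ω, (U ω + V ω) ^ 2 ∂P
      = ∫ ω, U ω ^ 2 ∂P + 2 * ∫ ω, U ω * V ω ∂P + ∫ ω, V ω ^ 2 ∂P := by
    rw [← integral_const_mul, ← integral_add (integrable_sq_of_hasGaussianLaw hU)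
      (iUV.const_mul 2), ← integral_add iS (integrable_sq_of_hasGaussianLaw hV)]
    exact integral_congr_ae (.of_forall fun ω => by simp only; ring)
  have d2 : ∫ ω, (U ω - V ω) ^ 2 ∂P
      = ∫ ω, U ω ^ 2 ∂P - 2 * ∫ ω, U ω * V ω ∂P + ∫ ω, V ω ^ 2 ∂P := by
    rw [← integral_const_mul, ← integral_sub (integrable_sq_of_hasGaussianLaw hU)
      (iUV.const_mul 2), ← integral_add iD (integrable_sq_of_hasGaussianLaw hV)]
    exact integral_congr_ae (.of_forall fun ω => by simp only; ring)
  -- Polarization, `12 U² V² = (U + V)⁴ + (U - V)⁴ - 2 U⁴ - 2 V⁴`, leaves only fourth moments of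
  -- one-dimensional Gaussians.
  have q : ∫ ω, U ω ^ 2 * V ω ^ 2 ∂P = (1 / 12) * (∫ ω, (U ω + V ω) ^ 4 ∂P
      + ∫ ω, (U ω - V ω) ^ 4 ∂P - 2 * (∫ ω, U ω ^ 4 ∂P + ∫ ω, V ω ^ 4 ∂P)) := by
    have i1 := integrable_pow_four_of_hasGaussianLaw hU
    have i2 := integrable_pow_four_of_hasGaussianLaw hV
    have i3 := integrable_pow_four_of_hasGaussianLaw hS
    have i4 := integrable_pow_four_of_hasGaussianLaw hD
    have i12 : Integrable (fun ω => 2 * (U ω ^ 4 + V ω ^ 4)) P := (i1.add i2).const_mul 2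
    have i34 : Integrable (fun ω => (U ω + V ω) ^ 4 + (U ω - V ω) ^ 4) P := i3.add i4
    rw [← integral_add i1 i2, ← integral_add i3 i4, ← integral_const_mul,
      ← integral_sub i34 i12, ← integral_const_mul]
    exact integral_congr_ae (.of_forall fun ω => by simp only; ring)
  rw [covariance_eq_sub (memLp_sq_of_hasGaussianLaw hU) (memLp_sq_of_hasGaussianLaw hV)]
  simp only [Pi.mul_apply]
  rw [q, integral_pow_four_of_hasGaussianLaw hU hU0, integral_pow_four_of_hasGaussianLaw hV hV0,
    integral_pow_four_of_hasGaussianLaw hS hS0, integral_pow_four_of_hasGaussianLaw hD hD0, s2, d2]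
  ring

/-- The covariance of two diagonal quadratic forms in centered Gaussian families. -/
lemma covariance_sum_sq_sum_sq [IsProbabilityMeasure P] {ι κ : Type*} [Fintype ι] [Fintype κ] {Y : ι → Ω → ℝ}
    {Z : κ → Ω → ℝ} (h : ∀ i k, HasGaussianLaw (fun ω => (Y i ω, Z k ω)) P)
    (hY : ∀ i, HasGaussianLaw (Y i) P) (hZ : ∀ k, HasGaussianLaw (Z k) P)
    (hY0 : ∀ i, P[Y i] = 0) (hZ0 : ∀ k, P[Z k] = 0) (a : ι → ℝ) (b : κ → ℝ) :
    cov[fun ω => ∑ i, a i * Y i ω ^ 2, fun ω => ∑ k, b k * Z k ω ^ 2; P]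
      = 2 * ∑ i, ∑ k, a i * b k * (∫ ω, Y i ω * Z k ω ∂P) ^ 2 := by
  rw [covariance_fun_sum_fun_sum (fun i => (memLp_sq_of_hasGaussianLaw (hY i)).const_mul (a i))
    (fun k => (memLp_sq_of_hasGaussianLaw (hZ k)).const_mul (b k)), Finset.mul_sum]
  refine Finset.sum_congr rfl fun i _ => ?_
  rw [Finset.mul_sum]
  refine Finset.sum_congr rfl fun k _ => ?_
  rw [covariance_const_mul_left, covariance_const_mul_right,
    covariance_sq_sq_of_hasGaussianLaw (h i k) (hY0 i) (hZ0 k)]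
  ring

end Moments

/-! ### Diagonalization of a quadratic form -/

section Diagonalization

open Matrix

variable {ι : Type*} [Fintype ι] [DecidableEq ι]

lemma trace_mul_self_eq_sum_eigenvalues_sq {M : Matrix ι ι ℝ} (hM : M.IsHermitian) :
    (M * M).trace = ∑ i, hM.eigenvalues i ^ 2 := by
  have h := hM.spectral_theorem
  have h2 : M * M = Unitary.conjStarAlgAut ℝ _ hM.eigenvectorUnitary
      (diagonal (RCLike.ofReal ∘ hM.eigenvalues) * diagonal (RCLike.ofReal ∘ hM.eigenvalues)) := by
    rw [map_mul, ← h]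
  rw [h2, Unitary.conjStarAlgAut_apply, Matrix.trace_mul_cycle, Unitary.coe_star_mul_self, one_mul,
    diagonal_mul_diagonal, trace_diagonal]
  simp [pow_two]

lemma sum_mul_mulVec_sq (A : Matrix ι ι ℝ) (hA : A.IsHermitian) (c x : ι → ℝ) :
    ∑ i, c i * (A *ᵥ x) i ^ 2 = x ⬝ᵥ (A * diagonal c * A) *ᵥ x := by
  rw [← mulVec_mulVec, ← mulVec_mulVec, dotProduct_mulVec, ← mulVec_transpose,
    ← conjTranspose_eq_transpose_of_trivial, hA.eq]
  simp only [dotProduct, mulVec_diagonal]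
  exact Finset.sum_congr rfl fun i _ => by ring

/-- Simultaneous description of `x ↦ ∑ c i (A x) i ^ 2` in an orthonormal eigenbasis. -/
lemma exists_orthonormalBasis_sum_mul_sq (A : Matrix ι ι ℝ) (hA : A.IsHermitian) (c : ι → ℝ) :
    ∃ (lam : ι → ℝ) (b : OrthonormalBasis ι ℝ (EuclideanSpace ℝ ι)),
      (∀ x : EuclideanSpace ℝ ι, ∑ i, c i * (A *ᵥ x) i ^ 2 = ∑ i, lam i * (inner ℝ (b i) x) ^ 2) ∧
      ∑ i, lam i = ∑ i, c i * (A * A) i i ∧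
      ∑ i, lam i ^ 2 = ∑ i, ∑ j, c i * c j * (A * A) i j ^ 2 := by
  have hM : (A * diagonal c * A).IsHermitian := by
    rw [IsHermitian, conjTranspose_mul, conjTranspose_mul, hA.eq, diagonal_conjTranspose,
      star_trivial, mul_assoc]
  have hsymm : ∀ i j, (A * A) i j = (A * A) j i := fun i j => by
    have : (A * A)ᵀ = A * A := by
      rw [transpose_mul, ← conjTranspose_eq_transpose_of_trivial, hA.eq]
    exact congrFun (congrFun this j) i
  refine ⟨hM.eigenvalues, hM.eigenvectorBasis, fun x => ?_, ?_, ?_⟩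
  · have hi : ∀ i, inner ℝ (hM.eigenvectorBasis i)
        (toEuclideanCLM (n := ι) (𝕜 := ℝ) (A * diagonal c * A) x)
        = hM.eigenvalues i * inner ℝ (hM.eigenvectorBasis i) x := by
      intro i
      rw [inner_toEuclideanCLM, dotProduct_mulVec, ← mulVec_transpose,
        ← conjTranspose_eq_transpose_of_trivial, hM.eq, hM.mulVec_eigenvectorBasis,
        smul_dotProduct, smul_eq_mul]
      congr 1
      simp [PiLp.inner_apply, dotProduct, mul_comm]
    rw [sum_mul_mulVec_sq A hA, ← inner_toEuclideanCLM,
      ← hM.eigenvectorBasis.sum_inner_mul_inner]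
    refine Finset.sum_congr rfl fun i _ => ?_
    rw [hi, real_inner_comm]
    ring
  · have h := hM.trace_eq_sum_eigenvalues
    rw [Matrix.trace_mul_cycle, Matrix.trace] at h
    simp only [RCLike.ofReal_real_eq_id, id_eq, diag_apply] at h
    rw [← h]
    exact Finset.sum_congr rfl fun i _ => by rw [mul_diagonal, mul_comm]
  · rw [← trace_mul_self_eq_sum_eigenvalues_sq hM]
    -- Cyclicity of the trace regroups the factors so that `A` enters only through `A * A`, the
    -- covariance matrix in the application.
    have e : (A * diagonal c * A * (A * diagonal c * A)).trace
        = ((A * A * diagonal c) * (A * A * diagonal c)).trace := by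
      rw [show A * diagonal c * A * (A * diagonal c * A)
        = A * (diagonal c * A * A * diagonal c * A) by simp only [mul_assoc], trace_mul_comm]
      rw [show diagonal c * A * A * diagonal c * A * A
        = diagonal c * (A * A * diagonal c * A * A) by simp only [mul_assoc], trace_mul_comm]
      simp only [mul_assoc]
    rw [e, Matrix.trace]
    refine Finset.sum_congr rfl fun i _ => ?_
    rw [diag_apply, mul_apply]
    refine Finset.sum_congr rfl fun j _ => ?_
    rw [mul_diagonal, mul_diagonal, hsymm j i]
    ring

end Diagonalization

/-! ### Characteristic functions of Gaussian quadratic forms -/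

/-- The characteristic function of `ξ ^ 2 - 1` for a standard Gaussian `ξ`. -/
noncomputable def chiSqCharFun (l : ℝ) : ℂ :=
  ∫ x, Complex.exp (Complex.I * (l * (x ^ 2 - 1) : ℝ)) ∂gaussianReal 0 1

lemma norm_integral_cexp_le_one {Ω : Type*} [MeasurableSpace Ω] (P : Measure Ω)
    [IsProbabilityMeasure P] (g : Ω → ℝ) : ‖∫ ω, Complex.exp (Complex.I * (g ω : ℝ)) ∂P‖ ≤ 1 := by
  have := norm_integral_le_of_norm_le_const (μ := P)
    (f := fun ω => Complex.exp (Complex.I * (g ω : ℝ))) (C := 1)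
    (.of_forall fun ω => by rw [Complex.norm_exp_I_mul_ofReal])
  simpa using this

lemma integral_sq_sub_one_gaussianReal : ∫ x, (x ^ 2 - 1) ∂gaussianReal 0 1 = 0 := by
  have hv := variance_eq_integral (μ := gaussianReal 0 1) (X := fun x => x) (by fun_prop)
  simp only [variance_fun_id_gaussianReal, integral_id_gaussianReal, sub_zero] at hv
  have hi : Integrable (fun x : ℝ => x ^ 2) (gaussianReal 0 1) :=
    (memLp_id_gaussianReal 2).integrable_sq
  rw [integral_sub hi (integrable_const _), ← hv]
  simp

lemma integral_sq_sub_one_sq_gaussianReal : ∫ x, (x ^ 2 - 1) ^ 2 ∂gaussianReal 0 1 = 2 := by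
  have hi : Integrable (fun x : ℝ => x ^ 2) (gaussianReal 0 1) :=
    (memLp_id_gaussianReal 2).integrable_sq
  have hi4 : Integrable (fun x : ℝ => x ^ 4) (gaussianReal 0 1) :=
    integrable_pow_four_of_hasGaussianLaw (U := id) IsGaussian.hasGaussianLaw_id
  have h2 := integral_sq_sub_one_gaussianReal
  rw [integral_sub hi (integrable_const _)] at h2
  have e : ∀ x : ℝ, (x ^ 2 - 1) ^ 2 = x ^ 4 - 2 * x ^ 2 + 1 := fun x => by ring
  have hi' : Integrable (fun x : ℝ => x ^ 4 - 2 * x ^ 2) (gaussianReal 0 1) :=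
    hi4.sub (hi.const_mul 2)
  simp_rw [e]
  rw [integral_add hi' (integrable_const _), integral_sub hi4 (hi.const_mul 2), integral_const_mul,
    integral_pow_four_gaussianReal]
  simp at h2 ⊢
  linarith

/-- `ξ ^ 2 - 1` has mean 0 and variance 2, so its characteristic function is `1 - l ^ 2 + o(l ^ 2)`,
the same expansion as that of `exp (-l ^ 2)`. Dividing by `√2` gives the unit variance needed for
the second-order Taylor formula. -/
lemma chiSqCharFun_sub_isLittleO :
    (fun l : ℝ => chiSqCharFun l - Complex.exp (-(l ^ 2 : ℝ))) =o[𝓝 0] fun l => l ^ 2 := by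
  set W : ℝ → ℝ := fun x => (x ^ 2 - 1) / √2 with hW
  have h2 : (√2 : ℝ) ≠ 0 := by positivity
  have hWm : AEMeasurable W (gaussianReal 0 1) := by fun_prop
  have hW0 : ∫ x, W x ∂gaussianReal 0 1 = 0 := by
    simp only [hW]
    rw [integral_div, integral_sq_sub_one_gaussianReal, zero_div]
  have hW1 : ∫ x, (W ^ 2) x ∂gaussianReal 0 1 = 1 := by
    simp only [hW, Pi.pow_apply, div_pow]
    rw [integral_div, integral_sq_sub_one_sq_gaussianReal, Real.sq_sqrt (by norm_num)]
    norm_num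
  have hT := taylor_charFun_two hWm hW0 hW1
  have hlim : Tendsto (fun l : ℝ => √2 * l) (𝓝 0) (𝓝 0) := by
    have : Continuous (fun l : ℝ => √2 * l) := by fun_prop
    simpa using this.tendsto 0
  have hT' := hT.comp_tendsto hlim
  have hchi : ∀ l : ℝ, charFun ((gaussianReal 0 1).map W) (√2 * l) = chiSqCharFun l := by
    intro l
    rw [charFun_apply_real, integral_map hWm (by fun_prop), chiSqCharFun]
    refine integral_congr_ae (.of_forall fun x => ?_)
    simp only [hW]
    congr 1
    have : (√2 * l) * ((x ^ 2 - 1) / √2) = l * (x ^ 2 - 1) := by field_simp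
    rw [← this]
    push_cast
    ring
  have h1 : (fun l : ℝ => chiSqCharFun l - (1 - (l : ℂ) ^ 2)) =o[𝓝 0] fun l : ℝ => l ^ 2 := by
    have : (fun l : ℝ => chiSqCharFun l - (1 - (l : ℂ) ^ 2)) =o[𝓝 0] fun l : ℝ => (√2 * l) ^ 2 := by
      refine hT'.congr (fun l => ?_) (fun l => rfl)
      simp only [Function.comp, hchi]
      congr 2
      have : ((√2 * l) ^ 2 / 2 : ℝ) = l ^ 2 := by
        rw [mul_pow, Real.sq_sqrt (by norm_num)]; ring
      exact_mod_cast congrArg (fun r : ℝ => (r : ℂ)) this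
    refine this.trans_isBigO ?_
    refine Asymptotics.IsBigO.of_bound 2 (.of_forall fun l => ?_)
    rw [mul_pow, Real.sq_sqrt (by norm_num), norm_mul]
    norm_num
  have h3 : (fun l : ℝ => (1 - (l : ℂ) ^ 2) - Complex.exp (-(l ^ 2 : ℝ)))
      =o[𝓝 0] fun l : ℝ => l ^ 2 := by
    have hs : Tendsto (fun l : ℝ => (-(l ^ 2 : ℝ) : ℂ)) (𝓝 0) (𝓝 0) := by
      have : Continuous (fun l : ℝ => (-(l ^ 2 : ℝ) : ℂ)) := by fun_prop
      simpa using this.tendsto 0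
    have := (Complex.exp_sub_sum_range_succ_isLittleO_pow 1).comp_tendsto hs
    refine (this.neg_left.congr (fun l => ?_) (fun l => rfl)).trans_isBigO ?_
    · simp [Finset.sum_range_succ]
      ring
    · refine Asymptotics.IsBigO.of_bound 1 (.of_forall fun l => ?_)
      simp
  refine (h1.add h3).congr (fun l => ?_) (fun l => rfl)
  ring

/-- Exchange the factors one at a time; all the others have modulus at most 1. This is the
comparison step of Lindeberg's argument. -/
lemma norm_prod_sub_prod_le_sum {ι : Type*} (s : Finset ι) (a b : ι → ℂ) (ha : ∀ i ∈ s, ‖a i‖ ≤ 1)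
    (hb : ∀ i ∈ s, ‖b i‖ ≤ 1) : ‖∏ i ∈ s, a i - ∏ i ∈ s, b i‖ ≤ ∑ i ∈ s, ‖a i - b i‖ := by
  classical
  induction s using Finset.induction_on with
  | empty => simp
  | insert i s his ih =>
    rw [Finset.prod_insert his, Finset.prod_insert his, Finset.sum_insert his]
    have ih' := ih (fun j hj => ha j (Finset.mem_insert_of_mem hj))
      (fun j hj => hb j (Finset.mem_insert_of_mem hj))
    have hp : ‖∏ j ∈ s, a j‖ ≤ 1 := by
      rw [norm_prod]
      exact Finset.prod_le_one (fun _ _ => norm_nonneg _)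
        (fun j hj => ha j (Finset.mem_insert_of_mem hj))
    have hbi := hb i (Finset.mem_insert_self _ _)
    calc ‖a i * ∏ j ∈ s, a j - b i * ∏ j ∈ s, b j‖
        = ‖(a i - b i) * ∏ j ∈ s, a j + b i * (∏ j ∈ s, a j - ∏ j ∈ s, b j)‖ := by
          congr 1; ring
      _ ≤ ‖a i - b i‖ * ‖∏ j ∈ s, a j‖ + ‖b i‖ * ‖∏ j ∈ s, a j - ∏ j ∈ s, b j‖ := by
          rw [← norm_mul, ← norm_mul]; exact norm_add_le _ _
      _ ≤ ‖a i - b i‖ + ∑ j ∈ s, ‖a j - b j‖ := by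
          refine add_le_add (mul_le_of_le_one_right (norm_nonneg _) hp) ?_
          exact (mul_le_of_le_one_left (norm_nonneg _) hbi).trans ih'

section QuadraticForm

variable {ι Ω : Type*} [Fintype ι] [MeasurableSpace Ω] {P : Measure Ω} {Y : ι → Ω → ℝ}

lemma integral_sum_mul_sq (hY : HasGaussianLaw (fun ω i => Y i ω) P) (v : ι → ℝ) :
    ∫ ω, (∑ i, v i * Y i ω) ^ 2 ∂P = ∑ i, ∑ j, v i * v j * ∫ ω, Y i ω * Y j ω ∂P := by
  have hint : ∀ i j, Integrable (fun ω => v i * v j * (Y i ω * Y j ω)) P := fun i j =>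
    ((hY.eval i).memLp_two.integrable_mul (hY.eval j).memLp_two).const_mul _
  simp_rw [← integral_const_mul]
  have h1 : ∀ i, ∑ j, ∫ ω, v i * v j * (Y i ω * Y j ω) ∂P
      = ∫ ω, ∑ j, v i * v j * (Y i ω * Y j ω) ∂P := fun i =>
    (integral_finsetSum _ fun j _ => hint i j).symm
  simp_rw [h1]
  rw [← integral_finsetSum _ fun i _ => integrable_finsetSum _ fun j _ => hint i j]
  refine integral_congr_ae (.of_forall fun ω => ?_)
  simp only
  rw [pow_two, Finset.sum_mul_sum]
  exact Finset.sum_congr rfl fun i _ => Finset.sum_congr rfl fun j _ => by ring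

variable (Y P) in
/-- The matrix of second moments of a finite family of random variables. -/
noncomputable def momentMatrix : Matrix ι ι ℝ := Matrix.of fun i j => ∫ ω, Y i ω * Y j ω ∂P

lemma dotProduct_momentMatrix_mulVec (hY : HasGaussianLaw (fun ω i => Y i ω) P) (v : ι → ℝ) :
    v ⬝ᵥ (momentMatrix P Y).mulVec v = ∫ ω, (∑ i, v i * Y i ω) ^ 2 ∂P := by
  rw [integral_sum_mul_sq hY]
  simp only [dotProduct, Matrix.mulVec, momentMatrix, Matrix.of_apply, Finset.mul_sum]
  exact Finset.sum_congr rfl fun i _ => Finset.sum_congr rfl fun j _ => by ring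

lemma posSemidef_momentMatrix (hY : HasGaussianLaw (fun ω i => Y i ω) P) :
    (momentMatrix P Y).PosSemidef := by
  refine Matrix.PosSemidef.of_dotProduct_mulVec_nonneg ?_ fun v => ?_
  · ext i j
    simp [momentMatrix, mul_comm]
  · rw [star_trivial, dotProduct_momentMatrix_mulVec hY]
    exact integral_nonneg fun ω => sq_nonneg _

variable [DecidableEq ι]

/-- A centered Gaussian law is determined by its second moments; this allows `Y` to be replaced by
the image of a standard Gaussian vector under `√Γ`. -/
lemma map_toLp_eq_multivariateGaussian (hY : HasGaussianLaw (fun ω i => Y i ω) P)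
    (hY0 : ∀ i, P[Y i] = 0) :
    P.map (fun ω => WithLp.toLp 2 (fun i => Y i ω)) = multivariateGaussian 0 (momentMatrix P Y) := by
  have hL := hY.toLp_pi 2
  have := hL.isGaussian_map
  refine Measure.ext_of_charFun (funext fun t => ?_)
  rw [hL.charFun_map_eq, charFun_multivariateGaussian (posSemidef_momentMatrix hY),
    dotProduct_momentMatrix_mulVec hY]
  have hin : ∀ ω, inner ℝ t (WithLp.toLp 2 (fun i => Y i ω)) = ∑ i, t i * Y i ω := fun ω => by
    simp [PiLp.inner_apply, mul_comm]
  have hmean : ∫ ω, ∑ i, t i * Y i ω ∂P = 0 := by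
    rw [integral_finsetSum _ fun i _ => (hY.eval i).integrable.const_mul _]
    simp [integral_const_mul, hY0]
  have hmeas : AEMeasurable (fun ω => ∑ i, t i * Y i ω) P :=
    Finset.aemeasurable_fun_sum _ fun i _ => (hY.eval i).aemeasurable.const_mul _
  simp only [hin]
  rw [variance_eq_integral hmeas, hmean]
  simp

open scoped MatrixOrder Matrix.Norms.L2Operator in
/-- A centered Gaussian quadratic form `∑ c i Y i ^ 2` has the law of `∑ lam i ξ i ^ 2` for
independent standard Gaussian `ξ i`, with control on the coefficients `lam i`. -/
lemma exists_charFun_sum_mul_sq (hY : HasGaussianLaw (fun ω i => Y i ω) P)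
    (hY0 : ∀ i, P[Y i] = 0) (c : ι → ℝ) :
    ∃ lam : ι → ℝ,
      ∫ ω, Complex.exp (Complex.I * (∑ i, c i * Y i ω ^ 2
        - ∑ i, c i * ∫ ω, Y i ω * Y i ω ∂P : ℝ)) ∂P = ∏ i, chiSqCharFun (lam i) ∧
      ∑ i, lam i ^ 2 = ∑ i, ∑ j, c i * c j * (∫ ω, Y i ω * Y j ω ∂P) ^ 2 ∧
      ∀ ε K : ℝ, 0 ≤ ε → (∀ i, |c i| ≤ ε) →
        (∀ v : ι → ℝ, ∫ ω, (∑ i, v i * Y i ω) ^ 2 ∂P ≤ K * ∑ i, v i ^ 2) →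
        ∀ i, |lam i| ≤ ε * K := by
  have hG := posSemidef_momentMatrix hY
  set Γ := momentMatrix P Y with hΓ
  set A := CFC.sqrt Γ with hA
  have hAA : A * A = Γ := CFC.sqrt_mul_sqrt_self _ hG.nonneg
  have hAh : A.IsHermitian := (CFC.sqrt_nonneg Γ).isSelfAdjoint
  obtain ⟨lam, b, hq, htr, hsq⟩ := exists_orthonormalBasis_sum_mul_sq A hAh c
  rw [hAA] at htr hsq
  refine ⟨lam, ?_, hsq, fun ε K hε hc hK i => ?_⟩
  · set m := ∑ i, c i * ∫ ω, Y i ω * Y i ω ∂P with hm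
    -- The centering constant is the trace of `A diag(c) A`, so it splits into one `λ i` for each
    -- square.
    have hm' : m = ∑ i, lam i := htr.symm
    have hL := hY.toLp_pi 2
    have e1 : ∫ ω, Complex.exp (Complex.I * (∑ i, c i * Y i ω ^ 2 - m : ℝ)) ∂P
        = ∫ y : EuclideanSpace ℝ ι, Complex.exp (Complex.I * (∑ i, c i * y i ^ 2 - m : ℝ))
          ∂(multivariateGaussian 0 Γ) := by
      rw [hΓ, ← map_toLp_eq_multivariateGaussian hY hY0, integral_map hL.aemeasurable (by fun_prop)]
    -- By rotation invariance the standard Gaussian may be expanded in the eigenbasis `b` with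
    -- independent standard coordinates; the integral then factorizes.
    rw [e1, multivariateGaussian, integral_map (by fun_prop) (by fun_prop),
      stdGaussian_eq_map_pi_orthonormalBasis b,
      integral_map (Measurable.aemeasurable (by fun_prop)) (by fun_prop)]
    have e2 : ∀ x : ι → ℝ, Complex.exp (Complex.I * (∑ i, c i * ((0 : EuclideanSpace ℝ ι)
        + Matrix.toEuclideanCLM (𝕜 := ℝ) A (∑ i, x i • b i)) i ^ 2 - m : ℝ))
        = ∏ i, Complex.exp (Complex.I * (lam i * (x i ^ 2 - 1) : ℝ)) := by
      intro x
      rw [← Complex.exp_sum, ← Finset.mul_sum, ← Complex.ofReal_sum, zero_add]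
      congr 3
      have h1 := hq (∑ i, x i • b i)
      have h2 : ∀ i, inner ℝ (b i) (∑ i, x i • b i) = x i := fun i => by
        rw [b.orthonormal.inner_right_fintype]
      simp only [h2] at h1
      rw [Matrix.ofLp_toEuclideanCLM, h1, hm', ← Finset.sum_sub_distrib]
      exact Finset.sum_congr rfl fun i _ => by ring
    simp_rw [← hA, e2]
    rw [integral_fintype_prod_eq_prod
      (f := fun i x => Complex.exp (Complex.I * (lam i * (x ^ 2 - 1) : ℝ)))]
    rfl
  · have h1 := hq (b i)
    have h2 : ∑ j, lam j * (inner ℝ (b j) (b i)) ^ 2 = lam i := by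
      rw [Finset.sum_eq_single i]
      · simp
      · intro j _ hj
        rw [b.orthonormal.2 hj]
        simp
      · simp
    have h3 : ∑ j, (A.mulVec (b i)) j ^ 2 = ∫ ω, (∑ j, b i j * Y j ω) ^ 2 ∂P := by
      rw [← dotProduct_momentMatrix_mulVec hY, ← hΓ]
      have := sum_mul_mulVec_sq A hAh (fun _ => 1) (b i)
      simpa [hAA] using this
    have h4 : ∑ j, b i j ^ 2 = 1 := by
      rw [← EuclideanSpace.real_norm_sq_eq, b.orthonormal.1 i, one_pow]
    rw [← h2, ← h1]
    calc |∑ j, c j * (A.mulVec (b i)) j ^ 2| ≤ ∑ j, |c j * (A.mulVec (b i)) j ^ 2| :=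
          Finset.abs_sum_le_sum_abs _ _
      _ ≤ ∑ j, ε * (A.mulVec (b i)) j ^ 2 := Finset.sum_le_sum fun j _ => by
          rw [abs_mul, abs_of_nonneg (sq_nonneg ((A.mulVec (b i)) j))]
          exact mul_le_mul_of_nonneg_right (hc j) (sq_nonneg _)
      _ = ε * ∫ ω, (∑ j, b i j * Y j ω) ^ 2 ∂P := by rw [← Finset.mul_sum, h3]
      _ ≤ ε * K := by
          refine mul_le_mul_of_nonneg_left ?_ hε
          simpa [h4] using hK (b i)

/-- Quantitative Gaussian approximation of a quadratic form whose coefficients are small. -/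
lemma norm_charFun_sum_mul_sq_sub_le (hY : HasGaussianLaw (fun ω i => Y i ω) P)
    (hY0 : ∀ i, P[Y i] = 0) (c : ι → ℝ) {δ η ε K : ℝ}
    (hδ : ∀ l : ℝ, |l| ≤ δ → ‖chiSqCharFun l - Complex.exp (-(l ^ 2 : ℝ))‖ ≤ η * l ^ 2)
    (hε : 0 ≤ ε) (hc : ∀ i, |c i| ≤ ε)
    (hK : ∀ v : ι → ℝ, ∫ ω, (∑ i, v i * Y i ω) ^ 2 ∂P ≤ K * ∑ i, v i ^ 2) (hεK : ε * K ≤ δ) :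
    ‖∫ ω, Complex.exp (Complex.I * (∑ i, c i * Y i ω ^ 2
        - ∑ i, c i * ∫ ω, Y i ω * Y i ω ∂P : ℝ)) ∂P
      - Complex.exp (-(∑ i, ∑ j, c i * c j * (∫ ω, Y i ω * Y j ω ∂P) ^ 2 : ℝ))‖
      ≤ η * ∑ i, ∑ j, c i * c j * (∫ ω, Y i ω * Y j ω ∂P) ^ 2 := by
  obtain ⟨lam, h1, h2, h3⟩ := exists_charFun_sum_mul_sq hY hY0 c
  have h4 : Complex.exp (-(∑ i, lam i ^ 2 : ℝ)) = ∏ i, Complex.exp (-(lam i ^ 2 : ℝ)) := by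
    rw [← Complex.exp_sum]
    push_cast
    rw [Finset.sum_neg_distrib]
  rw [h1, ← h2, h4, Finset.mul_sum]
  refine (norm_prod_sub_prod_le_sum _ _ _ (fun i _ => norm_integral_cexp_le_one _ _)
    (fun i _ => ?_)).trans (Finset.sum_le_sum fun i _ => hδ _ ((h3 ε K hε hc hK i).trans hεK))
  rw [← Complex.ofReal_neg, Complex.norm_exp_ofReal]
  exact Real.exp_le_one_iff.2 (by nlinarith [sq_nonneg (lam i)])

end QuadraticForm

/-! ### Second-order increments of a Gaussian process -/

lemma four_sub_two_rpow_pos {γ : ℝ} (hγ : γ < 1) : 0 < 4 - (2 : ℝ) ^ (2 * γ) := by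
  have : (2 : ℝ) ^ (2 * γ) < 2 ^ (2 : ℝ) :=
    Real.rpow_lt_rpow_of_exponent_lt (by norm_num) (by linarith)
  norm_num at this
  linarith

lemma grid_mem_Icc {T : ℝ} (hT : 0 ≤ T) {m : ℕ} {x : ℝ} (h0 : 0 ≤ x) (h1 : x ≤ m) :
    x / m * T ∈ Set.Icc 0 T :=
  ⟨by positivity, mul_le_of_le_one_left hT (div_le_one_of_le₀ h1 (Nat.cast_nonneg m))⟩

/-- Indices `(m, k)` with `1 ≤ k ≤ m - 1`. -/
abbrev GridIndex : Type := {p : ℕ × ℕ // p.2 ∈ Finset.Icc 1 (p.1 - 1)}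

lemma GridIndex.times_mem {T : ℝ} (hT : 0 ≤ T) (p : GridIndex) :
    ((p.1.2 : ℝ) + 1) / p.1.1 * T ∈ Set.Icc 0 T ∧ (p.1.2 : ℝ) / p.1.1 * T ∈ Set.Icc 0 T ∧
      ((p.1.2 : ℝ) - 1) / p.1.1 * T ∈ Set.Icc 0 T := by
  have hp := p.2
  rw [Finset.mem_Icc] at hp
  have h1 : (1 : ℝ) ≤ p.1.2 := by exact_mod_cast hp.1
  have h2 : (p.1.2 : ℝ) + 1 ≤ p.1.1 := by exact_mod_cast (by omega : p.1.2 + 1 ≤ p.1.1)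
  exact ⟨grid_mem_Icc hT (by linarith) h2, grid_mem_Icc hT (by linarith) (by linarith),
    grid_mem_Icc hT (by linarith) (by linarith)⟩

section NormalizedIncrements

variable {Ω : Type*} [MeasurableSpace Ω] {P : Measure Ω} {X : ℝ → Ω → ℝ} {T : ℝ}

lemma IsCenteredGaussianOn.hasGaussianLaw_eval (hX : IsCenteredGaussianOn X P T) {t : ℝ}
    (ht : t ∈ Set.Icc 0 T) : HasGaussianLaw (X t) P :=
  hX.gaussian.hasGaussianLaw_eval ⟨t, ht⟩

/-- Each increment is a linear function of three values of `X`. Indexing over all `m` at once gives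
joint Gaussianity across the two scales. -/
lemma IsCenteredGaussianOn.isGaussianProcess_normInc (hX : IsCenteredGaussianOn X P T)
    (hT : 0 ≤ T) (γ κ : ℝ) :
    IsGaussianProcess (fun p : GridIndex => normInc X T γ κ p.1.1 p.1.2) P := by
  classical
  refine hX.gaussian.of_isGaussianProcess fun p => ?_
  obtain ⟨h1, h2, h3⟩ := p.times_mem hT
  set a : Set.Icc (0 : ℝ) T := ⟨_, h1⟩ with ha
  set b : Set.Icc (0 : ℝ) T := ⟨_, h2⟩ with hb
  set c : Set.Icc (0 : ℝ) T := ⟨_, h3⟩ with hc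
  refine ⟨{a, b, c}, (κ * √(4 - (2 : ℝ) ^ (2 * γ)) * (T / p.1.1) ^ γ)⁻¹ •
    (ContinuousLinearMap.proj (R := ℝ) ⟨a, by simp⟩
      - (2 : ℝ) • ContinuousLinearMap.proj (R := ℝ) ⟨b, by simp⟩
      + ContinuousLinearMap.proj (R := ℝ) ⟨c, by simp⟩), fun ω => ?_⟩
  simp [normInc, secondInc, ha, hb, hc, div_eq_inv_mul, Finset.restrict_def]
  ring

lemma IsCenteredGaussianOn.integral_normInc (hX : IsCenteredGaussianOn X P T) (hT : 0 ≤ T)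
    (γ κ : ℝ) (p : GridIndex) : ∫ ω, normInc X T γ κ p.1.1 p.1.2 ω ∂P = 0 := by
  obtain ⟨h1, h2, h3⟩ := p.times_mem hT
  have i1 := (hX.hasGaussianLaw_eval h1).integrable
  have i2 := (hX.hasGaussianLaw_eval h2).integrable.const_mul 2
  have i3 := (hX.hasGaussianLaw_eval h3).integrable
  have i12 : Integrable (fun ω => X (((p.1.2 : ℝ) + 1) / p.1.1 * T) ω
    - 2 * X ((p.1.2 : ℝ) / p.1.1 * T) ω) P := i1.sub i2
  simp only [normInc, secondInc]
  rw [integral_div, integral_add i12 i3, integral_sub i1 i2, integral_const_mul,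
    hX.mean_zero _ h1, hX.mean_zero _ h2, hX.mean_zero _ h3]
  simp

lemma hasGaussianLaw_family {S ι : Type*} [Finite ι] {Z : S → Ω → ℝ}
    (hZ : IsGaussianProcess Z P) (e : ι → S) : HasGaussianLaw (fun ω i => Z (e i) ω) P := by
  cases nonempty_fintype ι
  let L : ({i // i ∈ (Finset.univ : Finset ι)} → ℝ) →L[ℝ] (ι → ℝ) :=
    ContinuousLinearMap.pi fun i => ContinuousLinearMap.proj ⟨i, Finset.mem_univ i⟩
  exact ((hZ.comp_right e).hasGaussianLaw Finset.univ).map_fun L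

lemma covariance_quadVar_quadVar [IsProbabilityMeasure P] (hX : IsCenteredGaussianOn X P T)
    (hT : 0 ≤ T) (γ κ : ℝ) (m l : ℕ) :
    cov[quadVar X T γ κ m, quadVar X T γ κ l; P]
      = 2 * ∑ j ∈ Finset.Icc 1 (m - 1), ∑ k ∈ Finset.Icc 1 (l - 1),
        (∫ ω, normInc X T γ κ m j ω * normInc X T γ κ l k ω ∂P) ^ 2 := by
  have hZ := hX.isGaussianProcess_normInc hT γ κ
  let e : (n : ℕ) → Finset.Icc 1 (n - 1) → GridIndex := fun n k => ⟨(n, k), k.2⟩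
  have hq : ∀ n, quadVar X T γ κ n
      = fun ω => ∑ k : Finset.Icc 1 (n - 1), (1 : ℝ) * normInc X T γ κ n k ω ^ 2 := fun n => by
    ext ω
    simp only [one_mul]
    rw [quadVar, ← Finset.sum_coe_sort]
  have h := covariance_sum_sq_sum_sq (P := P)
    (Y := fun j : Finset.Icc 1 (m - 1) => normInc X T γ κ m j)
    (Z := fun k : Finset.Icc 1 (l - 1) => normInc X T γ κ l k)
    (fun j k => hZ.hasGaussianLaw_prodMk (s := e m j) (t := e l k))
    (fun j => hZ.hasGaussianLaw_eval (e m j)) (fun k => hZ.hasGaussianLaw_eval (e l k))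
    (fun j => hX.integral_normInc hT γ κ (e m j)) (fun k => hX.integral_normInc hT γ κ (e l k))
    (fun _ => 1) (fun _ => 1)
  rw [hq m, hq l, h]
  simp only [one_mul]
  rw [← Finset.sum_coe_sort (Finset.Icc 1 (m - 1))]
  simp_rw [← Finset.sum_coe_sort (Finset.Icc 1 (l - 1))]

end NormalizedIncrements

/-! ### Fractional Brownian motion -/

section FBM

variable {Ω : Type*} [MeasurableSpace Ω] {P : Measure Ω} {B : ℝ → Ω → ℝ} {T γ : ℝ}

/-- The weights `1, -2, 1` sum to zero, which cancels the terms `t ^ (2 γ)` and `s ^ (2 γ)` and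
leaves a function of the time differences. -/
lemma IsFBM.integral_second_difference_mul (hB : IsFBM B P T γ) {t s : Fin 3 → ℝ}
    (ht : ∀ i, t i ∈ Set.Icc 0 T) (hs : ∀ i, s i ∈ Set.Icc 0 T) :
    ∫ ω, (B (t 0) ω - 2 * B (t 1) ω + B (t 2) ω) * (B (s 0) ω - 2 * B (s 1) ω + B (s 2) ω) ∂P
      = -(1 / 2) * (|t 0 - s 0| ^ (2 * γ) - 2 * |t 0 - s 1| ^ (2 * γ) + |t 0 - s 2| ^ (2 * γ)
        - 2 * |t 1 - s 0| ^ (2 * γ) + 4 * |t 1 - s 1| ^ (2 * γ) - 2 * |t 1 - s 2| ^ (2 * γ)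
        + |t 2 - s 0| ^ (2 * γ) - 2 * |t 2 - s 1| ^ (2 * γ) + |t 2 - s 2| ^ (2 * γ)) := by
  let a : Fin 3 → ℝ := ![1, -2, 1]
  have hint : ∀ i j, Integrable (fun ω => a i * a j * (B (t i) ω * B (s j) ω)) P := fun i j =>
    ((hB.hasGaussianLaw_eval (ht i)).memLp_two.integrable_mul
      (hB.hasGaussianLaw_eval (hs j)).memLp_two).const_mul _
  have e : ∀ ω, (B (t 0) ω - 2 * B (t 1) ω + B (t 2) ω) * (B (s 0) ω - 2 * B (s 1) ω + B (s 2) ω)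
      = ∑ i, ∑ j, a i * a j * (B (t i) ω * B (s j) ω) := fun ω => by
    simp only [Fin.sum_univ_three, a, Matrix.cons_val_zero, Matrix.cons_val_one, Matrix.cons_val]
    ring
  simp_rw [e]
  rw [integral_finsetSum _ fun i _ => integrable_finsetSum _ fun j _ => hint i j]
  have e2 : ∀ i, ∫ ω, ∑ j, a i * a j * (B (t i) ω * B (s j) ω) ∂P = ∑ j, a i * a j *
      ((1 / 2) * (t i ^ (2 * γ) + s j ^ (2 * γ) - |t i - s j| ^ (2 * γ))) := fun i => by
    rw [integral_finsetSum _ fun j _ => hint i j]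
    refine Finset.sum_congr rfl fun j _ => ?_
    rw [integral_const_mul, hB.covariance_eq _ (ht i) _ (hs j)]
  simp_rw [e2]
  simp only [Fin.sum_univ_three, a, Matrix.cons_val_zero, Matrix.cons_val_one, Matrix.cons_val]
  ring

/-- Self-similarity: with `h = T / l` as unit of length, `x` and `y` are the centers and `d` is the
step of the first increment. The cases used are `d = 1` and `d = 2`. -/
lemma IsFBM.integral_secondInc_mul (hB : IsFBM B P T γ) (hT : 0 ≤ T) {m l : ℕ} {j k : ℕ}
    (hj : j ∈ Finset.Icc 1 (m - 1)) (hk : k ∈ Finset.Icc 1 (l - 1)) {h x y d : ℝ} (hh : 0 ≤ h)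
    (hx : (j : ℝ) / m * T = x * h) (hd : T / m = d * h) (hy : (k : ℝ) / l * T = y * h)
    (hl : T / l = h) :
    ∫ ω, secondInc B T m j ω * secondInc B T l k ω ∂P
      = -(1 / 2) * (|x - y + d - 1| ^ (2 * γ) - 2 * |x - y + d| ^ (2 * γ)
        + |x - y + d + 1| ^ (2 * γ)
        - 2 * |x - y - 1| ^ (2 * γ) + 4 * |x - y| ^ (2 * γ) - 2 * |x - y + 1| ^ (2 * γ)
        + |x - y - d - 1| ^ (2 * γ) - 2 * |x - y - d| ^ (2 * γ) + |x - y - d + 1| ^ (2 * γ))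
        * h ^ (2 * γ) := by
  have hscale : ∀ z : ℝ, |z * h| ^ (2 * γ) = |z| ^ (2 * γ) * h ^ (2 * γ) := fun z => by
    rw [abs_mul, abs_of_nonneg hh, Real.mul_rpow (abs_nonneg _) hh]
  obtain ⟨t0, t1, t2⟩ := GridIndex.times_mem hT ⟨(m, j), hj⟩
  obtain ⟨s0, s1, s2⟩ := GridIndex.times_mem hT ⟨(l, k), hk⟩
  have a0 : ((j : ℝ) + 1) / m * T = (x + d) * h := by
    rw [add_mul, ← hx, ← hd]; ring
  have a2 : ((j : ℝ) - 1) / m * T = (x - d) * h := by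
    rw [sub_mul, ← hx, ← hd]; ring
  have b0 : ((k : ℝ) + 1) / l * T = (y + 1) * h := by
    rw [add_mul, ← hy, one_mul, ← hl]; ring
  have b2 : ((k : ℝ) - 1) / l * T = (y - 1) * h := by
    rw [sub_mul, ← hy, one_mul, ← hl]; ring
  simp only [secondInc]
  simp only [a0, hx, a2, b0, hy, b2] at t0 t1 t2 s0 s1 s2 ⊢
  have := hB.integral_second_difference_mul (t := ![(x + d) * h, x * h, (x - d) * h])
    (s := ![(y + 1) * h, y * h, (y - 1) * h])
    (by intro i; fin_cases i <;> assumption) (by intro i; fin_cases i <;> assumption)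
  simp only [Matrix.cons_val_zero, Matrix.cons_val_one, Matrix.cons_val, ← sub_mul, hscale] at this
  rw [this, show x + d - (y + 1) = x - y + d - 1 by ring, show x + d - y = x - y + d by ring,
    show x + d - (y - 1) = x - y + d + 1 by ring, show x - (y + 1) = x - y - 1 by ring,
    show x - (y - 1) = x - y + 1 by ring, show x - d - (y + 1) = x - y - d - 1 by ring,
    show x - d - y = x - y - d by ring, show x - d - (y - 1) = x - y - d + 1 by ring]
  ring

lemma integral_normInc_mul (B : ℝ → Ω → ℝ) (P : Measure Ω) (T γ κ : ℝ) (m l j k : ℕ) :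
    ∫ ω, normInc B T γ κ m j ω * normInc B T γ κ l k ω ∂P
      = (∫ ω, secondInc B T m j ω * secondInc B T l k ω ∂P)
        / ((κ * √(4 - (2 : ℝ) ^ (2 * γ)) * (T / m) ^ γ)
          * (κ * √(4 - (2 : ℝ) ^ (2 * γ)) * (T / l) ^ γ)) := by
  rw [← integral_div]
  exact integral_congr_ae (.of_forall fun ω => by simp only [normInc]; rw [div_mul_div_comm])

lemma IsFBM.integral_normInc_mul_same (hB : IsFBM B P T γ) (hT : 0 < T) (hγ : γ < 1) {n j k : ℕ}
    (hj : j ∈ Finset.Icc 1 (n - 1)) (hk : k ∈ Finset.Icc 1 (n - 1)) :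
    ∫ ω, normInc B T γ 1 n j ω * normInc B T γ 1 n k ω ∂P
      = rhoHat γ ((j : ℤ) - k) / (4 - (2 : ℝ) ^ (2 * γ)) := by
  have hn : (0 : ℝ) < n := by
    rw [Finset.mem_Icc] at hj
    exact_mod_cast (by omega : 0 < n)
  have hh : 0 < T / n := by positivity
  have h4 := four_sub_two_rpow_pos hγ
  rw [integral_normInc_mul, hB.integral_secondInc_mul hT.le hj hk (h := T / n) (x := j) (y := k)
    (d := 1) hh.le (by ring) (by ring) (by ring) rfl]
  have hden : (1 * √(4 - (2 : ℝ) ^ (2 * γ)) * (T / n) ^ γ)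
      * (1 * √(4 - (2 : ℝ) ^ (2 * γ)) * (T / n) ^ γ)
      = (4 - (2 : ℝ) ^ (2 * γ)) * (T / n) ^ (2 * γ) := by
    have : (T / n) ^ (2 * γ) = (T / n) ^ γ * (T / n) ^ γ := by
      rw [← Real.rpow_add hh]; ring_nf
    rw [this]
    nth_rewrite 3 [← Real.mul_self_sqrt h4.le]
    ring
  have hp : 0 < (T / n) ^ (2 * γ) := Real.rpow_pos_of_pos hh _
  rw [hden, mul_div_mul_right _ _ hp.ne']
  congr 1
  simp only [rhoHat]
  push_cast
  rw [show (j : ℝ) - k + 1 - 1 = j - k by ring, show (j : ℝ) - k + 1 + 1 = j - k + 2 by ring,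
    show (j : ℝ) - k - 1 - 1 = j - k - 2 by ring, show (j : ℝ) - k - 1 + 1 = j - k by ring]
  ring

lemma IsFBM.integral_normInc_mul_double (hB : IsFBM B P T γ) (hT : 0 < T) (hγ : γ < 1)
    {n j k : ℕ} (hj : j ∈ Finset.Icc 1 (n - 1)) (hk : k ∈ Finset.Icc 1 (2 * n - 1)) :
    ∫ ω, normInc B T γ 1 n j ω * normInc B T γ 1 (2 * n) k ω ∂P
      = rhoTilde γ (2 * (j : ℤ) - k) / ((2 : ℝ) ^ γ * (4 - (2 : ℝ) ^ (2 * γ))) := by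
  have hn : (0 : ℝ) < n := by
    rw [Finset.mem_Icc] at hj
    exact_mod_cast (by omega : 0 < n)
  have hcast : ((2 * n : ℕ) : ℝ) = 2 * n := by push_cast; ring
  have hh : 0 < T / (2 * n) := by positivity
  have h4 := four_sub_two_rpow_pos hγ
  rw [integral_normInc_mul, hB.integral_secondInc_mul hT.le hj hk (h := T / (2 * n))
    (x := 2 * j) (y := k) (d := 2) hh.le (by field_simp) (by field_simp)
    (by rw [hcast]; ring) (by rw [hcast]), hcast]
  have hden : (1 * √(4 - (2 : ℝ) ^ (2 * γ)) * (T / n) ^ γ)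
      * (1 * √(4 - (2 : ℝ) ^ (2 * γ)) * (T / (2 * n)) ^ γ)
      = (2 : ℝ) ^ γ * (4 - (2 : ℝ) ^ (2 * γ)) * (T / (2 * n)) ^ (2 * γ) := by
    have h1 : (T / (2 * n)) ^ (2 * γ) = (T / (2 * n)) ^ γ * (T / (2 * n)) ^ γ := by
      rw [← Real.rpow_add hh]; ring_nf
    have h2 : (T / n) ^ γ = 2 ^ γ * (T / (2 * n)) ^ γ := by
      rw [← Real.mul_rpow (by norm_num) hh.le]
      congr 1
      field_simp
    rw [h1, h2]
    nth_rewrite 3 [← Real.mul_self_sqrt h4.le]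
    ring
  have hp : 0 < (T / (2 * n)) ^ (2 * γ) := Real.rpow_pos_of_pos hh _
  rw [hden, mul_div_mul_right _ _ hp.ne']
  congr 1
  simp only [rhoTilde]
  push_cast
  rw [show (2 * j : ℝ) - k + 2 - 1 = 2 * j - k + 1 by ring,
    show (2 * j : ℝ) - k + 2 + 1 = 2 * j - k + 3 by ring,
    show (2 * j : ℝ) - k - 2 - 1 = 2 * j - k - 3 by ring,
    show (2 * j : ℝ) - k - 2 + 1 = 2 * j - k - 1 by ring]
  ring

lemma IsFBM.tendsto_covariance_same [IsProbabilityMeasure P] (hB : IsFBM B P T γ) (hT : 0 < T)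
    (hγ : γ ∈ Set.Ioo (0 : ℝ) 1) :
    Tendsto (fun n : ℕ => (1 / (n : ℝ)) * cov[quadVar B T γ 1 n, quadVar B T γ 1 n; P])
      atTop (𝓝 (sigma11 γ)) := by
  have h4 := (four_sub_two_rpow_pos hγ.2).ne'
  have h := (tendsto_average_sum (summable_rhoHat_sq hγ.2) (le_refl 1)).const_mul
    (2 / (4 - (2 : ℝ) ^ (2 * γ)) ^ 2)
  have hlim : 2 / (4 - (2 : ℝ) ^ (2 * γ)) ^ 2 * ∑' j : ℤ, rhoHat γ j ^ 2 = sigma11 γ := by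
    rw [tsum_rhoHat_sq hγ, sigma11]
    field_simp
  rw [hlim] at h
  refine h.congr fun n => ?_
  rw [covariance_quadVar_quadVar hB.toIsCenteredGaussianOn hT.le]
  have e : ∑ j ∈ Finset.Icc 1 (n - 1), ∑ k ∈ Finset.Icc 1 (n - 1),
      (∫ ω, normInc B T γ 1 n j ω * normInc B T γ 1 n k ω ∂P) ^ 2
      = (1 / (4 - (2 : ℝ) ^ (2 * γ)) ^ 2) * ∑ j ∈ Finset.Icc 1 (n - 1),
        ∑ k ∈ Finset.Icc 1 (n - 1), rhoHat γ ((j : ℤ) - k) ^ 2 := by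
    rw [Finset.mul_sum]
    refine Finset.sum_congr rfl fun j hj => ?_
    rw [Finset.mul_sum]
    refine Finset.sum_congr rfl fun k hk => ?_
    rw [hB.integral_normInc_mul_same hT hγ.2 hj hk, div_pow]
    ring
  rw [e]
  simp only [one_mul, Nat.cast_one]
  ring

/-- The limit carries a factor 2 because `sigma12` belongs to `V_{2n} / 2` rather than to `V_{2n}`.
-/
lemma IsFBM.tendsto_covariance_double [IsProbabilityMeasure P] (hB : IsFBM B P T γ) (hT : 0 < T)
    (hγ : γ ∈ Set.Ioo (0 : ℝ) 1) :
    Tendsto (fun n : ℕ => (1 / (n : ℝ)) * cov[quadVar B T γ 1 n, quadVar B T γ 1 (2 * n); P])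
      atTop (𝓝 (2 * sigma12 γ)) := by
  have h := (tendsto_average_sum (summable_rhoTilde_sq hγ.2) one_le_two).const_mul
    (2 / ((2 : ℝ) ^ (2 * γ) * (4 - (2 : ℝ) ^ (2 * γ)) ^ 2))
  have hlim : 2 / ((2 : ℝ) ^ (2 * γ) * (4 - (2 : ℝ) ^ (2 * γ)) ^ 2)
      * ∑' j : ℤ, rhoTilde γ j ^ 2 = 2 * sigma12 γ := by
    rw [sigma12]
    ring
  rw [hlim] at h
  refine h.congr fun n => ?_
  rw [covariance_quadVar_quadVar hB.toIsCenteredGaussianOn hT.le]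
  have e : ∑ j ∈ Finset.Icc 1 (n - 1), ∑ k ∈ Finset.Icc 1 (2 * n - 1),
      (∫ ω, normInc B T γ 1 n j ω * normInc B T γ 1 (2 * n) k ω ∂P) ^ 2
      = (1 / ((2 : ℝ) ^ (2 * γ) * (4 - (2 : ℝ) ^ (2 * γ)) ^ 2)) * ∑ j ∈ Finset.Icc 1 (n - 1),
        ∑ k ∈ Finset.Icc 1 (2 * n - 1), rhoTilde γ (2 * (j : ℤ) - k) ^ 2 := by
    have h2 : (2 : ℝ) ^ (2 * γ) = (2 ^ γ) ^ 2 := by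
      rw [pow_two, ← Real.rpow_add (by norm_num)]; ring_nf
    rw [Finset.mul_sum]
    refine Finset.sum_congr rfl fun j hj => ?_
    rw [Finset.mul_sum]
    refine Finset.sum_congr rfl fun k hk => ?_
    rw [hB.integral_normInc_mul_double hT hγ.2 hj hk, div_pow, mul_pow, ← h2]
    ring
  rw [e]
  simp only [Nat.cast_ofNat]
  ring

end FBM

/-! ### The joint family of increments at two scales -/

/-- Schur's test for a symmetric kernel. -/
lemma sum_sum_mul_le_of_row_bound {ι : Type*} [Fintype ι] {d : ι → ι → ℝ} {C : ℝ}
    (hsymm : ∀ i j, d i j = d j i) (hC : ∀ k, ∑ j, |d j k| ≤ C) (v : ι → ℝ) :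
    ∑ i, ∑ j, v i * v j * d i j ≤ C * ∑ i, v i ^ 2 := by
  have h1 : ∑ i, ∑ j, v i ^ 2 * |d i j| ≤ C * ∑ i, v i ^ 2 := by
    rw [Finset.mul_sum]
    refine Finset.sum_le_sum fun i _ => ?_
    rw [← Finset.mul_sum, mul_comm]
    refine mul_le_mul_of_nonneg_right ?_ (sq_nonneg _)
    simpa only [hsymm i] using hC i
  have h2 : ∑ i, ∑ j, v j ^ 2 * |d i j| ≤ C * ∑ i, v i ^ 2 := by
    rw [Finset.sum_comm]
    simpa only [fun i j => hsymm j i] using h1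
  have h3 : ∑ i, ∑ j, v i * v j * d i j
      ≤ ∑ i, ∑ j, ((1 / 2) * (v i ^ 2 * |d i j|) + (1 / 2) * (v j ^ 2 * |d i j|)) := by
    refine Finset.sum_le_sum fun i _ => Finset.sum_le_sum fun j _ => ?_
    have hle : v i * v j * d i j ≤ |v i * v j| * |d i j| := by
      rw [← abs_mul]; exact le_abs_self _
    have : |v i * v j| ≤ (1 / 2) * (v i ^ 2 + v j ^ 2) := by
      rw [abs_le]
      constructor <;> nlinarith [sq_nonneg (v i + v j), sq_nonneg (v i - v j)]
    nlinarith [abs_nonneg (d i j)]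
  simp only [Finset.sum_add_distrib, ← Finset.mul_sum] at h1 h3
  linarith

/-- Indices of the second-order increments at the scales `T / n` and `T / (2 n)`. -/
abbrev PairIndex (n : ℕ) : Type :=
  {k // k ∈ Finset.Icc 1 (n - 1)} ⊕ {k // k ∈ Finset.Icc 1 (2 * n - 1)}

/-- The normalized second-order increments at the scales `T / n` and `T / (2 n)`. -/
noncomputable def pairInc {Ω : Type*} (X : ℝ → Ω → ℝ) (T γ κ : ℝ) (n : ℕ) :
    PairIndex n → Ω → ℝ :=
  Sum.elim (fun k => normInc X T γ κ n k) (fun k => normInc X T γ κ (2 * n) k)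

lemma sum_mul_pairInc_sq {Ω : Type*} (X : ℝ → Ω → ℝ) (T γ κ a b : ℝ) (n : ℕ) (ω : Ω) :
    ∑ i : PairIndex n, Sum.elim (fun _ => a) (fun _ => b) i * pairInc X T γ κ n i ω ^ 2
      = a * quadVar X T γ κ n ω + b * quadVar X T γ κ (2 * n) ω := by
  rw [Fintype.sum_sum_type]
  simp only [Sum.elim_inl, Sum.elim_inr, pairInc, quadVar, Finset.mul_sum]
  rw [← Finset.sum_coe_sort (Finset.Icc 1 (n - 1)), ← Finset.sum_coe_sort (Finset.Icc 1 (2 * n - 1))]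

section Pair

variable {Ω : Type*} [MeasurableSpace Ω] {P : Measure Ω} {X : ℝ → Ω → ℝ} {T : ℝ}

lemma IsCenteredGaussianOn.hasGaussianLaw_pairInc (hX : IsCenteredGaussianOn X P T) (hT : 0 ≤ T)
    (γ κ : ℝ) (n : ℕ) : HasGaussianLaw (fun ω i => pairInc X T γ κ n i ω) P := by
  let e : PairIndex n → GridIndex :=
    Sum.elim (fun k => ⟨(n, k), k.2⟩) (fun k => ⟨(2 * n, k), k.2⟩)
  have h := hasGaussianLaw_family (hX.isGaussianProcess_normInc hT γ κ) e
  convert h using 3 with ω i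
  rcases i with i | i <;> rfl

lemma IsCenteredGaussianOn.integral_pairInc (hX : IsCenteredGaussianOn X P T) (hT : 0 ≤ T)
    (γ κ : ℝ) (n : ℕ) (i : PairIndex n) : P[pairInc X T γ κ n i] = 0 := by
  rcases i with i | i
  · exact hX.integral_normInc hT γ κ ⟨(n, i), i.2⟩
  · exact hX.integral_normInc hT γ κ ⟨(2 * n, i), i.2⟩

lemma IsCenteredGaussianOn.memLp_quadVar (hX : IsCenteredGaussianOn X P T) (hT : 0 ≤ T)
    (γ κ : ℝ) (m : ℕ) : MemLp (quadVar X T γ κ m) 2 P :=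
  memLp_finsetSum _ fun k hk => memLp_sq_of_hasGaussianLaw
    ((hX.isGaussianProcess_normInc hT γ κ).hasGaussianLaw_eval ⟨(m, k), hk⟩)

lemma IsCenteredGaussianOn.sum_mul_integral_pairInc [IsProbabilityMeasure P] (hX : IsCenteredGaussianOn X P T) (hT : 0 ≤ T)
    (γ κ a b : ℝ) (n : ℕ) :
    ∑ i : PairIndex n, Sum.elim (fun _ => a) (fun _ => b) i
        * ∫ ω, pairInc X T γ κ n i ω * pairInc X T γ κ n i ω ∂P
      = a * ∫ ω, quadVar X T γ κ n ω ∂P + b * ∫ ω, quadVar X T γ κ (2 * n) ω ∂P := by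
  have hY := hX.hasGaussianLaw_pairInc hT γ κ n
  have i1 := ((hX.memLp_quadVar hT γ κ n).integrable one_le_two).const_mul a
  have i2 := ((hX.memLp_quadVar hT γ κ (2 * n)).integrable one_le_two).const_mul b
  rw [← integral_const_mul, ← integral_const_mul, ← integral_add i1 i2]
  simp_rw [← sum_mul_pairInc_sq]
  rw [integral_finsetSum _ fun i _ =>
    (integrable_sq_of_hasGaussianLaw (hY.eval i)).const_mul _]
  simp_rw [integral_const_mul, pow_two]

lemma IsCenteredGaussianOn.sum_sum_mul_pairInc_sq [IsProbabilityMeasure P] (hX : IsCenteredGaussianOn X P T) (hT : 0 ≤ T)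
    (γ κ a b : ℝ) (n : ℕ) :
    ∑ i : PairIndex n, ∑ j : PairIndex n,
        Sum.elim (fun _ => a) (fun _ => b) i * Sum.elim (fun _ => a) (fun _ => b) j
        * (∫ ω, pairInc X T γ κ n i ω * pairInc X T γ κ n j ω ∂P) ^ 2
      = (1 / 2) * (a ^ 2 * cov[quadVar X T γ κ n, quadVar X T γ κ n; P]
        + 2 * (a * b) * cov[quadVar X T γ κ n, quadVar X T γ κ (2 * n); P]
        + b ^ 2 * cov[quadVar X T γ κ (2 * n), quadVar X T γ κ (2 * n); P]) := by
  have hY := hX.hasGaussianLaw_pairInc hT γ κ n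
  have h := covariance_sum_sq_sum_sq (P := P) (Y := pairInc X T γ κ n) (Z := pairInc X T γ κ n)
    (fun i k => hY.prodMk i k) (fun i => hY.eval i) (fun i => hY.eval i)
    (hX.integral_pairInc hT γ κ n) (hX.integral_pairInc hT γ κ n)
    (Sum.elim (fun _ => a) (fun _ => b)) (Sum.elim (fun _ => a) (fun _ => b))
  simp_rw [sum_mul_pairInc_sq] at h
  have m1 := (hX.memLp_quadVar hT γ κ n).const_mul a
  have m2 := (hX.memLp_quadVar hT γ κ (2 * n)).const_mul b
  have hadd : (fun ω => a * quadVar X T γ κ n ω + b * quadVar X T γ κ (2 * n) ω)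
      = (fun ω => a * quadVar X T γ κ n ω) + fun ω => b * quadVar X T γ κ (2 * n) ω := rfl
  rw [hadd, covariance_add_left m1 m2 (m1.add m2), covariance_add_right m1 m1 m2,
    covariance_add_right m2 m1 m2] at h
  simp only [covariance_const_mul_left, covariance_const_mul_right] at h
  rw [covariance_comm (quadVar X T γ κ (2 * n)) (quadVar X T γ κ n)] at h
  linarith

lemma IsCenteredGaussianOn.integral_sum_normInc_sq_le (hX : IsCenteredGaussianOn X P T)
    (hT : 0 ≤ T) {γ κ C : ℝ} {m : ℕ}
    (hC : ∀ k ∈ Finset.Icc 1 (m - 1), ∑ j ∈ Finset.Icc 1 (m - 1), |incCov X P T γ κ m j k| ≤ C)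
    (v : Finset.Icc 1 (m - 1) → ℝ) :
    ∫ ω, (∑ i, v i * normInc X T γ κ m i ω) ^ 2 ∂P ≤ C * ∑ i, v i ^ 2 := by
  let e : {k // k ∈ Finset.Icc 1 (m - 1)} → GridIndex := fun k => ⟨(m, k), k.2⟩
  have h := hasGaussianLaw_family (hX.isGaussianProcess_normInc hT γ κ) e
  rw [integral_sum_mul_sq (Y := fun i : {k // k ∈ Finset.Icc 1 (m - 1)} => normInc X T γ κ m i) h]
  refine sum_sum_mul_le_of_row_bound
    (d := fun i j : {k // k ∈ Finset.Icc 1 (m - 1)} => incCov X P T γ κ m i j)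
    (fun i j => ?_) (fun k => ?_) v
  · simp only [incCov, mul_comm]
  · have := hC k k.2
    rwa [← Finset.sum_coe_sort (Finset.Icc 1 (m - 1))] at this

/-- The row bounds control each scale separately but not the covariances between scales. Splitting
by `(x + y) ^ 2 ≤ 2 x ^ 2 + 2 y ^ 2` avoids the latter at the cost of the factor 2. -/
lemma IsCenteredGaussianOn.integral_sum_pairInc_sq_le (hX : IsCenteredGaussianOn X P T)
    (hT : 0 ≤ T) {γ κ C : ℝ} {n : ℕ}
    (h1 : ∀ k ∈ Finset.Icc 1 (n - 1), ∑ j ∈ Finset.Icc 1 (n - 1), |incCov X P T γ κ n j k| ≤ C)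
    (h2 : ∀ k ∈ Finset.Icc 1 (2 * n - 1),
      ∑ j ∈ Finset.Icc 1 (2 * n - 1), |incCov X P T γ κ (2 * n) j k| ≤ C)
    (v : PairIndex n → ℝ) :
    ∫ ω, (∑ i, v i * pairInc X T γ κ n i ω) ^ 2 ∂P ≤ 2 * C * ∑ i, v i ^ 2 := by
  have hY := hX.hasGaussianLaw_pairInc hT γ κ n
  have b1 := hX.integral_sum_normInc_sq_le hT h1 (fun i => v (Sum.inl i))
  have b2 := hX.integral_sum_normInc_sq_le hT h2 (fun i => v (Sum.inr i))
  have hm : ∀ i : PairIndex n, MemLp (fun ω => v i * pairInc X T γ κ n i ω) 2 P :=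
    fun i => (hY.eval i).memLp_two.const_mul _
  have i1 : Integrable (fun ω => (∑ i : {k // k ∈ Finset.Icc 1 (n - 1)},
      v (Sum.inl i) * normInc X T γ κ n i ω) ^ 2) P :=
    (memLp_finsetSum _ fun i _ => hm (Sum.inl i)).integrable_sq
  have i2 : Integrable (fun ω => (∑ i : {k // k ∈ Finset.Icc 1 (2 * n - 1)},
      v (Sum.inr i) * normInc X T γ κ (2 * n) i ω) ^ 2) P :=
    (memLp_finsetSum _ fun i _ => hm (Sum.inr i)).integrable_sq
  have i0 : Integrable (fun ω => (∑ i, v i * pairInc X T γ κ n i ω) ^ 2) P :=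
    (memLp_finsetSum _ fun i _ => hm i).integrable_sq
  have hle := integral_mono i0 ((i1.const_mul 2).add (i2.const_mul 2)) (fun ω => by
    simp only [Pi.add_apply]
    rw [Fintype.sum_sum_type]
    simp only [pairInc, Sum.elim_inl, Sum.elim_inr]
    exact (add_sq_le (a := ∑ i : {k // k ∈ Finset.Icc 1 (n - 1)},
      v (Sum.inl i) * normInc X T γ κ n i ω)).trans_eq (mul_add _ _ _))
  refine hle.trans ?_
  simp only [Pi.add_apply]
  rw [integral_add (i1.const_mul 2) (i2.const_mul 2), integral_const_mul, integral_const_mul,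
    Fintype.sum_sum_type]
  linarith

end Pair

/-! ### The limit theorem -/

section Limit

variable {Ω : Type*} [MeasurableSpace Ω] {P : Measure Ω} [IsProbabilityMeasure P]
  {X : ℝ → Ω → ℝ} {T γ κ : ℝ}

/-- Half the variance of `(a V_n + b V_{2n} / 2) / √n`. -/
lemma IsCenteredGaussianOn.tendsto_sum_sum_pairInc (hX : IsCenteredGaussianOn X P T) (hT : 0 ≤ T)
    {s11 s12 s22 : ℝ}
    (h11 : Tendsto (fun n : ℕ => (1 / (n : ℝ)) * cov[quadVar X T γ κ n, quadVar X T γ κ n; P])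
      atTop (𝓝 s11))
    (h12 : Tendsto (fun n : ℕ => (1 / (n : ℝ)) * cov[quadVar X T γ κ n, quadVar X T γ κ (2 * n); P])
      atTop (𝓝 (2 * s12)))
    (h22 : Tendsto
      (fun n : ℕ => (1 / (n : ℝ)) * cov[quadVar X T γ κ (2 * n), quadVar X T γ κ (2 * n); P])
      atTop (𝓝 (4 * s22))) (a b : ℝ) :
    Tendsto (fun n : ℕ => ∑ i : PairIndex n, ∑ j : PairIndex n,
        Sum.elim (fun _ => a / √n) (fun _ => b / (2 * √n)) i
        * Sum.elim (fun _ => a / √n) (fun _ => b / (2 * √n)) j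
        * (∫ ω, pairInc X T γ κ n i ω * pairInc X T γ κ n j ω ∂P) ^ 2) atTop
      (𝓝 ((a ^ 2 * s11 + 2 * (a * b) * s12 + b ^ 2 * s22) / 2)) := by
  have h := (((h11.const_mul (a ^ 2)).add (h12.const_mul (a * b))).add
    (h22.const_mul (b ^ 2 / 4))).div_const 2
  have hlim : (a ^ 2 * s11 + a * b * (2 * s12) + b ^ 2 / 4 * (4 * s22)) / 2
      = (a ^ 2 * s11 + 2 * (a * b) * s12 + b ^ 2 * s22) / 2 := by ring
  rw [hlim] at h
  refine h.congr fun n => ?_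
  rw [hX.sum_sum_mul_pairInc_sq hT]
  have hs : (√(n : ℝ)) ^ 2 = n := Real.sq_sqrt (Nat.cast_nonneg n)
  rw [div_pow, div_pow, mul_pow, hs, div_mul_div_comm,
    show √(n : ℝ) * (2 * √n) = 2 * (√n) ^ 2 by ring, hs]
  ring

/-- Convergence of the characteristic function of the centered statistic. -/
lemma IsCenteredGaussianOn.tendsto_charFun_centered (hX : IsCenteredGaussianOn X P T) (hT : 0 ≤ T)
    {C : ℝ}
    (hC1 : ∀ n : ℕ, 1 ≤ n → ∀ k ∈ Finset.Icc 1 (n - 1),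
      ∑ j ∈ Finset.Icc 1 (n - 1), |incCov X P T γ κ n j k| ≤ C)
    (hC2 : ∀ n : ℕ, 1 ≤ n → ∀ k ∈ Finset.Icc 1 (2 * n - 1),
      ∑ j ∈ Finset.Icc 1 (2 * n - 1), |incCov X P T γ κ (2 * n) j k| ≤ C)
    (a b q : ℝ)
    (hq : Tendsto (fun n : ℕ => ∑ i : PairIndex n, ∑ j : PairIndex n,
        Sum.elim (fun _ => a / √n) (fun _ => b / (2 * √n)) i
        * Sum.elim (fun _ => a / √n) (fun _ => b / (2 * √n)) j
        * (∫ ω, pairInc X T γ κ n i ω * pairInc X T γ κ n j ω ∂P) ^ 2) atTop (𝓝 q)) :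
    Tendsto (fun n : ℕ => ∫ ω, Complex.exp (Complex.I *
      (a / √n * quadVar X T γ κ n ω + b / (2 * √n) * quadVar X T γ κ (2 * n) ω
        - (a / √n * ∫ ω, quadVar X T γ κ n ω ∂P
          + b / (2 * √n) * ∫ ω, quadVar X T γ κ (2 * n) ω ∂P) : ℝ)) ∂P)
      atTop (𝓝 (Complex.exp (-(q : ℂ)))) := by
  set Q : ℕ → ℝ := fun n => ∑ i : PairIndex n, ∑ j : PairIndex n,
        Sum.elim (fun _ => a / √n) (fun _ => b / (2 * √n)) i
        * Sum.elim (fun _ => a / √n) (fun _ => b / (2 * √n)) j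
        * (∫ ω, pairInc X T γ κ n i ω * pairInc X T γ κ n j ω ∂P) ^ 2 with hQ
  have hexp : Tendsto (fun n => Complex.exp (-(Q n : ℂ))) atTop (𝓝 (Complex.exp (-(q : ℂ)))) := by
    have hc : Continuous (fun x : ℝ => Complex.exp (-(x : ℂ))) := by fun_prop
    exact (hc.tendsto q).comp hq
  have hε : Tendsto (fun n : ℕ => (|a| + |b|) / √(n : ℝ)) atTop (𝓝 0) :=
    tendsto_const_nhds.div_atTop (Real.tendsto_sqrt_atTop.comp tendsto_natCast_atTop_atTop)
  have hεK : Tendsto (fun n : ℕ => (|a| + |b|) / √(n : ℝ) * (2 * C)) atTop (𝓝 0) := by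
    simpa using hε.mul_const (2 * C)
  have hdiff : Tendsto (fun n : ℕ => (∫ ω, Complex.exp (Complex.I *
      (a / √n * quadVar X T γ κ n ω + b / (2 * √n) * quadVar X T γ κ (2 * n) ω
        - (a / √n * ∫ ω, quadVar X T γ κ n ω ∂P
          + b / (2 * √n) * ∫ ω, quadVar X T γ κ (2 * n) ω ∂P) : ℝ)) ∂P)
        - Complex.exp (-(Q n : ℂ))) atTop (𝓝 0) := by
    rw [Metric.tendsto_nhds]
    intro r hr
    -- Eventually `Q n < |q| + 1`, so this slope makes the total error `η * Q n` smaller than `r`.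
    have hη : 0 < r / (|q| + 2) := by positivity
    obtain ⟨δ, hδ0, hδ⟩ := Metric.eventually_nhds_iff.1 (chiSqCharFun_sub_isLittleO.bound hη)
    have hδ' : ∀ l : ℝ, |l| ≤ δ / 2 →
        ‖chiSqCharFun l - Complex.exp (-(l ^ 2 : ℝ))‖ ≤ r / (|q| + 2) * l ^ 2 := fun l hl => by
      have := hδ (y := l) (by rw [Real.dist_eq, sub_zero]; linarith)
      rwa [Real.norm_of_nonneg (sq_nonneg l)] at this
    filter_upwards [eventually_ge_atTop 1, hεK.eventually (ge_mem_nhds (half_pos hδ0)),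
      hq.eventually (gt_mem_nhds (show q < |q| + 1 by linarith [le_abs_self q]))] with n hn hn1 hn2
    have h := norm_charFun_sum_mul_sq_sub_le (hX.hasGaussianLaw_pairInc hT γ κ n)
      (hX.integral_pairInc hT γ κ n) (Sum.elim (fun _ => a / √n) (fun _ => b / (2 * √n)))
      (ε := (|a| + |b|) / √(n : ℝ)) (K := 2 * C) hδ' (by positivity) (fun i => by
        have hs := Real.sqrt_nonneg (n : ℝ)
        rcases i with i | i
        · simp only [Sum.elim_inl]
          rw [abs_div, abs_of_nonneg hs]
          exact div_le_div_of_nonneg_right (by linarith [abs_nonneg b]) hs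
        · simp only [Sum.elim_inr]
          rw [abs_div, abs_mul, abs_of_nonneg hs, abs_two, ← div_div]
          exact div_le_div_of_nonneg_right (by linarith [abs_nonneg a, abs_nonneg b]) hs)
      (hX.integral_sum_pairInc_sq_le hT (hC1 n hn) (hC2 n hn)) hn1
    rw [hX.sum_mul_integral_pairInc hT] at h
    simp only [sum_mul_pairInc_sq] at h
    rw [dist_zero_right]
    refine h.trans_lt ?_
    calc r / (|q| + 2) * Q n ≤ r / (|q| + 2) * (|q| + 1) :=
          mul_le_mul_of_nonneg_left hn2.le hη.le
      _ < r := by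
          rw [div_mul_eq_mul_div, div_lt_iff₀ (by positivity)]
          nlinarith
  simpa using hdiff.add hexp

end Limit

/-! ### Proof of the theorem -/

lemma posSemidef_fin_two_of_quadratic_nonneg {p q r : ℝ}
    (h : ∀ a b : ℝ, 0 ≤ a ^ 2 * p + 2 * (a * b) * q + b ^ 2 * r) :
    (!![p, q; q, r] : Matrix (Fin 2) (Fin 2) ℝ).PosSemidef := by
  refine Matrix.PosSemidef.of_dotProduct_mulVec_nonneg ?_ fun x => ?_
  · ext i j
    fin_cases i <;> fin_cases j <;> rfl
  · have := h (x 0) (x 1)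
    simp [dotProduct, Matrix.mulVec, Fin.sum_univ_two]
    linarith

lemma IsFBM.tendsto_covariance_double_double {Ω : Type*} [MeasurableSpace Ω] {P : Measure Ω}
    [IsProbabilityMeasure P] {B : ℝ → Ω → ℝ} {T γ : ℝ} (hB : IsFBM B P T γ) (hT : 0 < T)
    (hγ : γ ∈ Set.Ioo (0 : ℝ) 1) :
    Tendsto (fun n : ℕ => (1 / (n : ℝ)) *
      cov[quadVar B T γ 1 (2 * n), quadVar B T γ 1 (2 * n); P]) atTop
      (𝓝 (4 * ((1 / 2) * sigma11 γ))) := by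
  have h := ((hB.tendsto_covariance_same hT hγ).comp
    (tendsto_id.const_mul_atTop' (zero_lt_two (α := ℕ)))).const_mul 2
  rw [show 4 * ((1 / 2) * sigma11 γ) = 2 * sigma11 γ by ring]
  refine h.congr fun n => ?_
  simp only [Function.comp, id]
  push_cast
  rw [one_div_mul_eq_div, one_div_mul_eq_div, mul_div_assoc', mul_div_mul_left _ _ two_ne_zero]

lemma IsCenteredGaussianOn.aemeasurable_quadVar {Ω : Type*} [MeasurableSpace Ω] {P : Measure Ω}
    {X : ℝ → Ω → ℝ} {T : ℝ} (hX : IsCenteredGaussianOn X P T) (hT : 0 ≤ T) (γ κ : ℝ) (m : ℕ) :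
    AEMeasurable (quadVar X T γ κ m) P :=
  (hX.memLp_quadVar hT γ κ m).aestronglyMeasurable.aemeasurable

end OreyCLT

open OreyCLT in
theorem corollaryc {Ω Ω' : Type*} [MeasurableSpace Ω] [MeasurableSpace Ω']
    (P : Measure Ω) [IsProbabilityMeasure P] (P' : Measure Ω') [IsProbabilityMeasure P']
    (T : ℝ) (hT : 0 < T) (γ : ℝ) (hγ : γ ∈ Set.Ioo (0 : ℝ) 1) (κ : ℝ)
    (X : ℝ → Ω → ℝ) (hX : OreyCLT.IsCenteredGaussianOn X P T) (hX0 : X 0 =ᵐ[P] 0)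
    (hOrey : OreyCLT.HasOreyIndex X P T γ)
    (hκ : OreyCLT.IsNormalizingConstant X P T γ κ)
    (hmax : ∃ C : ℝ, ∀ n : ℕ, 1 ≤ n → ∀ i ∈ ({1, 2} : Set ℕ),
      ∀ k ∈ Finset.Icc 1 (i * n - 1),
        ∑ j ∈ Finset.Icc 1 (i * n - 1), |OreyCLT.incCov X P T γ κ (i * n) j k| ≤ C)
    (B : ℝ → Ω' → ℝ) (hB : OreyCLT.IsFBM B P' T γ)
    (hcov : ∀ i ∈ ({1, 2} : Set ℕ), ∀ j ∈ ({1, 2} : Set ℕ),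
      Tendsto (fun n : ℕ => (1 / (n : ℝ)) *
        (cov[fun ω => (i : ℝ)⁻¹ * OreyCLT.quadVar X T γ κ (i * n) ω,
            fun ω => (j : ℝ)⁻¹ * OreyCLT.quadVar X T γ κ (j * n) ω; P]
          - cov[fun ω => (i : ℝ)⁻¹ * OreyCLT.quadVar B T γ 1 (i * n) ω,
            fun ω => (j : ℝ)⁻¹ * OreyCLT.quadVar B T γ 1 (j * n) ω; P']))
        atTop (𝓝 0))
    (hmean : ∀ i ∈ ({1, 2} : Set ℕ),
      Tendsto (fun n : ℕ => √(n : ℝ) *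
        (((i : ℝ) * n)⁻¹ * (∫ ω, OreyCLT.quadVar X T γ κ (i * n) ω ∂P) - 1))
        atTop (𝓝 0)) :
    Summable (fun j : ℕ => (OreyCLT.rhoHat γ ((j : ℤ) + 1)) ^ 2) ∧
    Summable (fun j : ℤ => (OreyCLT.rhoTilde γ j) ^ 2) ∧
    (OreyCLT.SigmaMatrix γ).PosSemidef ∧
    TendstoInDistribution
      (fun (n : ℕ) ω =>
        !₂[√(n : ℝ) * ((n : ℝ)⁻¹ * OreyCLT.quadVar X T γ κ n ω - 1),
           √(n : ℝ) * ((2 * (n : ℝ))⁻¹ * OreyCLT.quadVar X T γ κ (2 * n) ω - 1)])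
      atTop (id : EuclideanSpace ℝ (Fin 2) → EuclideanSpace ℝ (Fin 2)) (fun _ => P)
      (multivariateGaussian 0 (OreyCLT.SigmaMatrix γ)) := by
  have hγ1 := hγ.2
  have c11 := (hcov 1 (by simp) 1 (by simp)).add (hB.tendsto_covariance_same hT hγ)
  -- The multipliers 2 here and 4 below undo the weights `i⁻¹ j⁻¹` in assumption 2.
  have c12 := ((hcov 1 (by simp) 2 (by simp)).const_mul 2).add (hB.tendsto_covariance_double hT hγ)
  have c22 := ((hcov 2 (by simp) 2 (by simp)).const_mul 4).add
    (hB.tendsto_covariance_double_double hT hγ)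
  simp only [Nat.cast_one, Nat.cast_ofNat, covariance_const_mul_left,
    covariance_const_mul_right, one_mul, inv_one, zero_add, mul_zero] at c11 c12 c22
  have l11 : Tendsto (fun n : ℕ => (1 / (n : ℝ)) * cov[quadVar X T γ κ n, quadVar X T γ κ n; P])
      atTop (𝓝 (sigma11 γ)) := c11.congr fun n => by ring
  have l12 : Tendsto
      (fun n : ℕ => (1 / (n : ℝ)) * cov[quadVar X T γ κ n, quadVar X T γ κ (2 * n); P])
      atTop (𝓝 (2 * sigma12 γ)) := c12.congr fun n => by ring
  have l22 : Tendsto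
      (fun n : ℕ => (1 / (n : ℝ)) * cov[quadVar X T γ κ (2 * n), quadVar X T γ κ (2 * n); P])
      atTop (𝓝 (4 * ((1 / 2) * sigma11 γ))) := c22.congr fun n => by ring
  have hq := hX.tendsto_sum_sum_pairInc hT.le l11 l12 l22
  have hpsd : (SigmaMatrix γ).PosSemidef := by
    refine posSemidef_fin_two_of_quadratic_nonneg fun a b => ?_
    -- Half the limiting quadratic form is a limit of sums of squared eigenvalues, hence
    -- nonnegative.
    have : 0 ≤ (a ^ 2 * sigma11 γ + 2 * (a * b) * sigma12 γ + b ^ 2 * ((1 / 2) * sigma11 γ)) / 2 := by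
      refine ge_of_tendsto' (hq a b) fun n => ?_
      obtain ⟨lam, -, h2, -⟩ := exists_charFun_sum_mul_sq (hX.hasGaussianLaw_pairInc hT.le γ κ n)
        (hX.integral_pairInc hT.le γ κ n) (Sum.elim (fun _ => a / √n) (fun _ => b / (2 * √n)))
      rw [← h2]
      exact Finset.sum_nonneg fun i _ => sq_nonneg _
    linarith
  have hmeas : ∀ n : ℕ, AEMeasurable (fun ω =>
      !₂[√(n : ℝ) * ((n : ℝ)⁻¹ * quadVar X T γ κ n ω - 1),
        √(n : ℝ) * ((2 * (n : ℝ))⁻¹ * quadVar X T γ κ (2 * n) ω - 1)]) P := fun n => by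
    have h1 := hX.aemeasurable_quadVar hT.le γ κ n
    have h2 := hX.aemeasurable_quadVar hT.le γ κ (2 * n)
    refine (WithLp.measurable_toLp 2 _).comp_aemeasurable (aemeasurable_pi_lambda _ fun i => ?_)
    fin_cases i
    · exact ((h1.const_mul _).sub_const _).const_mul _
    · exact ((h2.const_mul _).sub_const _).const_mul _
  refine ⟨?_, summable_rhoTilde_sq hγ1, hpsd, ⟨hmeas, aemeasurable_id, ?_⟩⟩
  · exact_mod_cast (summable_nat_add_iff 1).2 (summable_rhoHat_sq_nat hγ1)
  refine ProbabilityMeasure.tendsto_iff_tendsto_charFun.2 fun t => ?_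
  simp only [ProbabilityMeasure.coe_mk, Measure.map_id]
  obtain ⟨C, hC⟩ := hmax
  have hchar := hX.tendsto_charFun_centered hT.le (C := C)
    (fun n hn => by simpa using hC n hn 1 (by simp)) (fun n hn => hC n hn 2 (by simp))
    (t 0) (t 1) _ (hq (t 0) (t 1))
  have hm1 := (hmean 1 (by simp)).const_mul (t 0)
  have hm2 := (hmean 2 (by simp)).const_mul (t 1)
  simp only [Nat.cast_one, Nat.cast_ofNat, one_mul, mul_zero] at hm1 hm2
  have hmu := hm1.add hm2
  rw [add_zero] at hmu
  have hphase : Continuous (fun x : ℝ => Complex.exp (Complex.I * (x : ℂ))) := by fun_prop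
  -- The bias of the mean enters as a deterministic phase tending to 1, multiplying the
  -- characteristic function of the centered statistic.
  have hlim := ((hphase.tendsto 0).comp hmu).mul hchar
  have htarget : charFun (multivariateGaussian 0 (SigmaMatrix γ)) t
      = Complex.exp (Complex.I * ((0 : ℝ) : ℂ)) * Complex.exp (-(((t 0 ^ 2 * sigma11 γ
        + 2 * (t 0 * t 1) * sigma12 γ + t 1 ^ 2 * ((1 / 2) * sigma11 γ)) / 2 : ℝ) : ℂ)) := by
    rw [charFun_multivariateGaussian hpsd, ← Complex.exp_add]
    congr 1
    simp [SigmaMatrix, dotProduct, Matrix.mulVec, Fin.sum_univ_two]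
    ring
  rw [htarget]
  refine hlim.congr' ?_
  filter_upwards [eventually_ge_atTop 1] with n hn
  have hn0 : (0 : ℝ) < n := by exact_mod_cast hn
  rw [charFun_apply, integral_map (hmeas n) (by fun_prop)]
  simp only [Function.comp]
  rw [← integral_const_mul]
  refine integral_congr_ae (.of_forall fun ω => ?_)
  simp only
  rw [← Complex.exp_add, ← mul_add, ← Complex.ofReal_add, mul_comm Complex.I]
  congr 3
  have hs : √(n : ℝ) * (n : ℝ)⁻¹ = (√(n : ℝ))⁻¹ := by
    rw [← div_eq_mul_inv, Real.sqrt_div_self']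
    exact one_div _
  simp only [PiLp.inner_apply, Fin.sum_univ_two, RCLike.inner_apply, conj_trivial,
    Matrix.cons_val_zero, Matrix.cons_val_one]
  linear_combination (t 0 * (∫ ω, quadVar X T γ κ n ω ∂P - quadVar X T γ κ n ω)
    + t 1 / 2 * (∫ ω, quadVar X T γ κ (2 * n) ω ∂P - quadVar X T γ κ (2 * n) ω)) * hs
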